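/- **Theorem.** A function $f:\{0,1\}^n\to\{0,1\}$ is *intersecting* if whenever $f(x)=f(y)=1$ (possibly with $x=y$) there is a coordinate $i\in[n]$ with $x_i=y_i=1$. It is *$\varepsilon$-far* from intersecting if $\Pr_{x\in\{0,1\}^n}[f(x)\neq g(x)]\ge\varepsilon$ (with $x$ uniform) for every intersecting $g:\{0,1\}^n\to\{0,1\}$. A *non-adaptive $q$-query algorithm* is a probability distribution over pairs consisting of $q$ query points in $\{0,1\}^n$ and an accept/reject rule applied to the $q$ values of $f$ at these points. It is a (two-sided) *$\varepsilon$-tester for intersectingness with success probability $p$* if it accepts every intersecting $f$ with probability at least $p$ and rejects every $f$ that is $\varepsilon$-far from intersecting with probability at least $p$. Fix a constant success probability $p>1/2$ (for instance $p=2/3$). Then there are constants $c>0$ and $\kappa>0$ (depending only on $p$) such that for every integer $n\ge 1$ and every real $\varepsilon$ with $c>\varepsilon\ge 1/\sqrt n$, every non-adaptive $\varepsilon$-tester for intersectingness of functions $f:\{0,1\}^n\to\{0,1\}$ with success probability $p$ makes $$q\;\ge\;2^{\kappa\, n^{1/4}/\sqrt{\varepsilon}}$$ queries. -/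

import Mathlib

namespace PropertyTesting

/-- The Boolean cube `{0,1}^n`. -/
abbrev Cube (n : ℕ) : Type := Fin n → Bool

/-- Boolean functions `f : {0,1}^n → {0,1}`. -/
abbrev BoolFun (n : ℕ) : Type := Cube n → Bool

/-- `f` is intersecting: whenever `f x = f y = 1` (possibly with `x = y`), some coordinate `i` has
`x i = y i = 1`. -/
def IsIntersecting {n : ℕ} (f : BoolFun n) : Prop :=
  ∀ x y : Cube n, f x = true → f y = true → ∃ i : Fin n, x i = true ∧ y i = true

/-- Normalized Hamming distance `Pr_x [f x ≠ g x]`, with `x` uniform in `{0,1}^n`. -/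
noncomputable def hdist {n : ℕ} (f g : BoolFun n) : ℝ :=
  ((Finset.univ.filter fun x : Cube n => f x ≠ g x).card : ℝ) / 2 ^ n

/-- `f` is `ε`-far from the property `P`: the minimum over `g ∈ P` of `hdist f g` is at
least `ε`. -/
def IsFar {n : ℕ} (ε : ℝ) (f : BoolFun n) (P : Set (BoolFun n)) : Prop :=
  ∀ g ∈ P, ε ≤ hdist f g

/-- A deterministic non-adaptive algorithm making `q` queries to a function on `{0,1}^n`: the query
points are fixed in advance, and the verdict is an arbitrary function of the `q` answers
(`true` means "accept", `false` means "reject"). -/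
structure DetAlg (n q : ℕ) where
  query : Fin q → Cube n
  verdict : (Fin q → Bool) → Bool

/-- The verdict of a deterministic non-adaptive algorithm on input `f`. -/
def DetAlg.run {n q : ℕ} (A : DetAlg n q) (f : BoolFun n) : Bool :=
  A.verdict fun i => f (A.query i)

/-- A randomized non-adaptive `q`-query algorithm: a probability distribution over deterministic
non-adaptive `q`-query algorithms. -/
abbrev RandAlg (n q : ℕ) : Type := PMF (DetAlg n q)

/-- The probability that the randomized algorithm `A` outputs the verdict `b` on input `f`. -/
noncomputable def RandAlg.prob {n q : ℕ} (A : RandAlg n q) (f : BoolFun n) (b : Bool) : ℝ :=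
  (PMF.map (fun D : DetAlg n q => D.run f) A b).toReal

/-- `A` is a (two-sided error) `ε`-tester for the property `P` with success probability `p`: it
accepts every `f ∈ P`, and rejects every `f` that is `ε`-far from `P`, with probability at
least `p`. -/
def IsTester {n q : ℕ} (A : RandAlg n q) (P : Set (BoolFun n)) (ε p : ℝ) : Prop :=
  (∀ f : BoolFun n, f ∈ P → p ≤ RandAlg.prob A f true) ∧
  (∀ f : BoolFun n, IsFar ε f P → p ≤ RandAlg.prob A f false)

end PropertyTesting

/-! ### Finiteness of algorithms and Yao's principle. -/

namespace PropertyTesting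

/-! By `yao_principle` it suffices to find a random intersecting function and a random, mostly far,
function that no fixed small set of queries tells apart. Split the coordinates at random into `a`
action and `2h` control coordinates, with `a` of order `√n/ε`, and draw `2^a` random terms, each
made of `a` control coordinates. Consider control points `z` whose weight is within order `ε√n` of
`h`. Such a `z` has label `(i, j)` if term `i` is the only one satisfied by `z` and term `j` the
only one satisfied by `zᶜ`. The window holds at least a fraction of order `ε` of the control cube
(`card_window_ge`), and because `a` times its radius is at most `h`, a constant fraction of it is
labelled on average (`sum_card_labelled_ge`). Every unordered pair of terms gets a random bit. At a
labelled point with low or high action part the function is this bit, flipped according to the order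
of `i` and `j` (yes case) or according to whether the action part is low (no case); elsewhere it is
`0`.

Disjoint labelled control points have swapped labels. In the yes case their values are then never
both `1`, so the function is intersecting (`isIntersecting_hardFun`). In the no case, if the bit of
`z` is `0`, the function is `1` on all low points over `z` and over `zᶜ`, and a vertex-cover count
in each weight layer shows that an intersecting function must change many of them
(`card_activeControls_mul_lowCount_le`). A second-moment bound provides enough such `z`.

Re-randomising the bits by a fixed XOR turns the yes answers into the no answers
(`exists_perm_hardFun_eq`), unless two queries, or a query and the complement of one, satisfy a
common term although their action parts are far apart. Sharing a term forces the control parts to be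
close, while a random splitting distributes differences mostly over the control part. So each pair
collides with probability `exp(-Ω(√a))` (`card_collide_le`), where `√a` is of order `n^{1/4}/√ε`,
and a union bound over the `q²` pairs concludes. -/

instance finite_detAlg (n q : ℕ) : Finite (DetAlg n q) :=
  Finite.of_injective (fun D : DetAlg n q => (D.query, D.verdict)) (by
    rintro ⟨a, b⟩ ⟨c, d⟩ h
    simpa using h)

theorem prob_eq_sum {n q : ℕ} [Fintype (DetAlg n q)] (A : RandAlg n q) (f : BoolFun n) (b : Bool) :
    RandAlg.prob A f b = ∑ D, (A D).toReal * (if D.run f = b then 1 else 0) := by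
  classical
  unfold RandAlg.prob
  rw [PMF.map_apply, tsum_fintype, ENNReal.toReal_sum]
  · refine Finset.sum_congr rfl fun D _ => ?_
    by_cases h : D.run f = b
    · simp [h]
    · have h' : ¬ b = D.run f := fun e => h e.symm
      simp [h, h']
  · intro D _
    split_ifs
    · exact A.apply_ne_top D
    · simp

theorem prob_false_add_true {n q : ℕ} (A : RandAlg n q) (f : BoolFun n) :
    RandAlg.prob A f false + RandAlg.prob A f true = 1 := by
  unfold RandAlg.prob
  have h := (PMF.map (fun D : DetAlg n q => D.run f) A).tsum_coe
  rw [tsum_fintype, Fintype.sum_bool] at h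
  rw [← ENNReal.toReal_add (PMF.apply_ne_top _ _) (PMF.apply_ne_top _ _), add_comm, h]
  simp

/-- Yao's principle: if the uniform distributions on `yes` and `no` cannot be told apart by a
deterministic algorithm, then no tester has large success probability. -/
theorem yao_principle {n q : ℕ} {P : Set (BoolFun n)} {ε p : ℝ} {A : RandAlg n q}
    (hA : IsTester A P ε p) {Ω : Type*} (s : Finset Ω) (hs : s.Nonempty)
    (yes no : Ω → BoolFun n) (hyes : ∀ ω ∈ s, yes ω ∈ P) {ξ η : ℝ}
    (hfar : ∃ B ⊆ s, (B.card : ℝ) ≤ η * s.card ∧ ∀ ω ∈ s, ω ∉ B → IsFar ε (no ω) P)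
    (hind : ∀ D : DetAlg n q, ((s.filter fun ω => D.run (yes ω) = true).card : ℝ) ≤
      (s.filter fun ω => D.run (no ω) = true).card + ξ * s.card) :
    2 * p - 1 ≤ ξ + η := by
  classical
  have := Fintype.ofFinite (DetAlg n q)
  have hscard : (0 : ℝ) < s.card := by exact_mod_cast hs.card_pos
  have key : ∀ g : Ω → BoolFun n, ∑ ω ∈ s, RandAlg.prob A (g ω) true =
      ∑ D, (A D).toReal * ((s.filter fun ω => D.run (g ω) = true).card : ℝ) := by
    intro g
    simp_rw [prob_eq_sum]
    rw [Finset.sum_comm]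
    refine Finset.sum_congr rfl fun D _ => ?_
    rw [← Finset.mul_sum, Finset.sum_boole]
  have hone : ∑ D, (A D).toReal = 1 := by
    have h := A.tsum_coe
    rw [tsum_fintype] at h
    rw [← ENNReal.toReal_sum fun D _ => A.apply_ne_top D, h, ENNReal.toReal_one]
  have h1 : p * s.card ≤ ∑ ω ∈ s, RandAlg.prob A (yes ω) true := by
    rw [mul_comm, ← nsmul_eq_mul, ← Finset.sum_const]
    exact Finset.sum_le_sum fun ω hω => hA.1 _ (hyes ω hω)
  have hpos : ∀ f b, 0 ≤ RandAlg.prob A f b := fun f b => ENNReal.toReal_nonneg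
  have hp1 : p ≤ 1 := by
    obtain ⟨ω, hω⟩ := hs
    have := hA.1 _ (hyes ω hω)
    linarith [prob_false_add_true A (yes ω), hpos (yes ω) false]
  obtain ⟨B, hBs, hBcard, hB⟩ := hfar
  have h2 : p * (s.card - B.card) ≤ ∑ ω ∈ s, RandAlg.prob A (no ω) false := by
    have e : ((s \ B).card : ℝ) = s.card - B.card := by
      rw [Finset.card_sdiff_of_subset hBs, Nat.cast_sub (Finset.card_le_card hBs)]
    rw [← e, mul_comm, ← nsmul_eq_mul, ← Finset.sum_const]
    refine (Finset.sum_le_sum fun ω hω => ?_).trans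
      (Finset.sum_le_sum_of_subset_of_nonneg Finset.sdiff_subset fun _ _ _ => hpos _ _)
    rw [Finset.mem_sdiff] at hω
    exact hA.2 _ (hB ω hω.1 hω.2)
  have h3 : ∑ ω ∈ s, RandAlg.prob A (no ω) false + ∑ ω ∈ s, RandAlg.prob A (no ω) true =
      s.card := by
    rw [← Finset.sum_add_distrib]
    simp [prob_false_add_true]
  have h4 : ∑ ω ∈ s, RandAlg.prob A (yes ω) true ≤
      ∑ ω ∈ s, RandAlg.prob A (no ω) true + ξ * s.card := by
    rw [key, key]
    calc _ ≤ ∑ D, (A D).toReal * (((s.filter fun ω => D.run (no ω) = true).card : ℝ)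
            + ξ * s.card) :=
          Finset.sum_le_sum fun D _ => mul_le_mul_of_nonneg_left (hind D) ENNReal.toReal_nonneg
      _ = _ := by
          simp_rw [mul_add]
          rw [Finset.sum_add_distrib, ← Finset.sum_mul, hone, one_mul]
  have h5 : p * B.card ≤ η * s.card :=
    (mul_le_of_le_one_left (Nat.cast_nonneg _) hp1).trans hBcard
  have h6 : (2 * p - 1) * s.card ≤ (ξ + η) * s.card := by nlinarith
  exact le_of_mul_le_mul_right h6 hscard

/-! ### Hamming weights, layers of the cube and disjoint pairs. -/

section Weight
variable {ι : Type*} [Fintype ι]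

/-- The Hamming weight of a point of a Boolean cube. -/
def weight (x : ι → Bool) : ℕ := (Finset.univ.filter fun i => x i = true).card

theorem weight_add_weight_compl (x : ι → Bool) : weight x + weight xᶜ = Fintype.card ι := by
  classical
  unfold weight
  rw [← Finset.card_univ, ← Finset.card_filter_add_card_filter_not (s := Finset.univ)
    (fun i => x i = true)]
  congr 2
  ext i
  simp

theorem weight_eq_sum (x : ι → Bool) : weight x = ∑ i, if x i = true then 1 else 0 := by
  unfold weight
  rw [Finset.card_filter]

theorem hammingDist_eq_sum (x y : ι → Bool) :
    hammingDist x y = ∑ i, if x i ≠ y i then 1 else 0 := by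
  unfold hammingDist
  rw [Finset.card_filter]

theorem two_mul_weight_inf_add (x y : ι → Bool) :
    2 * weight (x ⊓ y) + hammingDist x y = weight x + weight y := by
  simp only [weight_eq_sum, hammingDist_eq_sum, Finset.mul_sum, ← Finset.sum_add_distrib]
  refine Finset.sum_congr rfl fun i _ => ?_
  cases hx : x i <;> cases hy : y i <;> simp [hx, hy]

theorem weight_le_add_hammingDist (x y : ι → Bool) : weight x ≤ weight y + hammingDist x y := by
  simp only [weight_eq_sum, hammingDist_eq_sum, ← Finset.sum_add_distrib]
  refine Finset.sum_le_sum fun i _ => ?_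
  cases hx : x i <;> cases hy : y i <;> simp

variable [DecidableEq ι]

/-- Points of the cube correspond to subsets of the index set. -/
def cubeEquivFinset (ι : Type*) [Fintype ι] [DecidableEq ι] : (ι → Bool) ≃ Finset ι where
  toFun x := Finset.univ.filter fun i => x i = true
  invFun s i := decide (i ∈ s)
  left_inv x := by ext i; simp
  right_inv s := by ext i; simp

theorem card_weight_eq (k : ℕ) :
    (Finset.univ.filter fun x : ι → Bool => weight x = k).card = (Fintype.card ι).choose k := by
  rw [← Finset.card_univ, ← Finset.card_powersetCard]
  refine Finset.card_equiv (cubeEquivFinset ι) fun x => ?_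
  simp only [Finset.mem_filter, Finset.mem_univ, true_and, Finset.mem_powersetCard,
    Finset.subset_univ]
  exact Iff.rfl

open Classical in
/-- The number of points of weight `k` disjoint from a given point. -/
theorem card_weight_eq_disjoint (u : ι → Bool) (k : ℕ) :
    (Finset.univ.filter fun v : ι → Bool => weight v = k ∧ Disjoint u v).card =
      (weight uᶜ).choose k := by
  classical
  have : weight uᶜ = (cubeEquivFinset ι uᶜ).card := rfl
  rw [this, ← Finset.card_powersetCard]
  refine Finset.card_equiv (cubeEquivFinset ι) fun v => ?_
  simp only [Finset.mem_filter, Finset.mem_univ, true_and, Finset.mem_powersetCard]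
  rw [and_comm]
  refine and_congr ?_ (by simp [weight, cubeEquivFinset])
  rw [disjoint_comm, ← le_compl_iff_disjoint_right]
  simp only [cubeEquivFinset, Equiv.coe_fn_mk, Finset.subset_iff, Finset.mem_filter,
    Finset.mem_univ, true_and, Pi.le_def]
  exact Iff.rfl

/-- If every disjoint pair of weight-`k` points meets `S` (first coordinate) or `S'` (second
coordinate), then `S` and `S'` together have at least `choose _ k` points of weight `k`. -/
theorem choose_le_card_add_card (S S' : Finset (ι → Bool)) {k : ℕ} (hk : 2 * k ≤ Fintype.card ι)
    (h : ∀ u v : ι → Bool, weight u = k → weight v = k → Disjoint u v → u ∈ S ∨ v ∈ S') :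
    (Fintype.card ι).choose k ≤
      (S.filter fun u => weight u = k).card + (S'.filter fun u => weight u = k).card := by
  classical
  set N := Fintype.card ι with hN
  set d := (N - k).choose k with hd
  have hdpos : 0 < d := Nat.choose_pos (by omega)
  have hdeg : ∀ u : ι → Bool, weight u = k →
      (Finset.univ.filter fun v : ι → Bool => weight v = k ∧ Disjoint u v).card = d := by
    intro u hu
    rw [card_weight_eq_disjoint]
    have := weight_add_weight_compl u
    rw [hd, show weight uᶜ = N - k by omega]
  set V := Finset.univ.filter fun x : ι → Bool => weight x = k with hV
  have hsum : ∑ u ∈ V, (Finset.univ.filter fun v : ι → Bool => weight v = k ∧ Disjoint u v).card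
      = N.choose k * d := by
    rw [Finset.sum_congr rfl fun u hu => hdeg u (Finset.mem_filter.1 hu).2, Finset.sum_const,
      card_weight_eq, smul_eq_mul]
  -- Disjointness is a `d`-regular relation on the layer. Every disjoint pair is covered by `S` or
  -- `S'`, and each point of these sets covers exactly `d` pairs, so dividing by `d` gives the
  -- claim.
  have hle : ∑ u ∈ V, (Finset.univ.filter fun v : ι → Bool => weight v = k ∧ Disjoint u v).card
      ≤ ∑ u ∈ V, ∑ v ∈ V, ((if u ∈ S ∧ Disjoint u v then 1 else 0) +
          if v ∈ S' ∧ Disjoint u v then 1 else 0) := by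
    refine Finset.sum_le_sum fun u hu => ?_
    rw [← Finset.filter_filter, Finset.card_filter]
    refine Finset.sum_le_sum fun v hv => ?_
    have := h u v (Finset.mem_filter.1 hu).2 (Finset.mem_filter.1 hv).2
    by_cases huv : Disjoint u v
    · rcases this huv with h1 | h1 <;> simp [huv, h1]
    · simp [huv]
  have hpart : ∀ (R : Finset (ι → Bool)) (rel : (ι → Bool) → (ι → Bool) → Prop)
      [DecidableRel rel], (∀ u v, rel u v ↔ Disjoint u v) →
      ∑ u ∈ V, ∑ v ∈ V, (if u ∈ R ∧ rel u v then 1 else 0) =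
        (R.filter fun u => weight u = k).card * d := by
    intro R rel _ hrel
    have : (R.filter fun u => weight u = k) = V.filter fun u => u ∈ R := by
      ext u; simp [hV, and_comm]
    rw [this, Finset.card_filter, Finset.sum_mul]
    refine Finset.sum_congr rfl fun u hu => ?_
    by_cases hR : u ∈ R
    · simp only [hR, true_and, if_true, one_mul, hrel]
      rw [← Finset.card_filter, hV, Finset.filter_filter]
      exact hdeg u (Finset.mem_filter.1 hu).2
    · simp [hR]
  have h1 := hpart S (fun u v => Disjoint u v) fun u v => Iff.rfl
  have h2 := hpart S' (fun u v => Disjoint v u) fun u v => disjoint_comm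
  rw [Finset.sum_comm] at h2
  simp_rw [Finset.sum_add_distrib] at hle
  rw [h1, h2, hsum, ← add_mul] at hle
  exact Nat.le_of_mul_le_mul_right hle hdpos

end Weight

/-! ### Terms and the labels they induce on control points. -/

section Terms
variable {L k m : ℕ}

/-- A point satisfies a term if it has a one at every coordinate of the term. -/
def Sat (t : Fin k → Fin m) (z : Fin m → Bool) : Prop := ∀ u, z (t u) = true

instance (t : Fin k → Fin m) (z : Fin m → Bool) : Decidable (Sat t z) :=
  inferInstanceAs (Decidable (∀ u, z (t u) = true))

theorem Sat.mono {t : Fin k → Fin m} {z z' : Fin m → Bool} (h : Sat t z) (hz : z ≤ z') :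
    Sat t z' := fun u => Bool.eq_true_of_true_le (h u ▸ hz (t u))

theorem sat_inf {t : Fin k → Fin m} {z z' : Fin m → Bool} :
    Sat t (z ⊓ z') ↔ Sat t z ∧ Sat t z' := by
  simp [Sat, forall_and]

theorem not_sat_compl_of_sat (hk : 0 < k) {t : Fin k → Fin m} {z : Fin m → Bool} (h : Sat t z) :
    ¬ Sat t zᶜ := fun h' => by
  have h1 := h ⟨0, hk⟩
  have h2 := h' ⟨0, hk⟩
  simp [h1] at h2

theorem card_sat (z : Fin m → Bool) :
    (Finset.univ.filter fun t : Fin k → Fin m => Sat t z).card = weight z ^ k := by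
  have : (Finset.univ.filter fun t : Fin k → Fin m => Sat t z) =
      Fintype.piFinset fun _ : Fin k => Finset.univ.filter fun i => z i = true := by
    ext t
    simp only [Finset.mem_filter, Finset.mem_univ, true_and, Fintype.mem_piFinset]
    exact Iff.rfl
  rw [this, Fintype.card_piFinset]
  simp [weight]

/-- `z` satisfies exactly the term `i` and avoids exactly the term `j`. -/
def Label (T : Fin L → Fin k → Fin m) (z : Fin m → Bool) (i j : Fin L) : Prop :=
  (∀ l, Sat (T l) z ↔ l = i) ∧ ∀ l, Sat (T l) zᶜ ↔ l = j

instance (T : Fin L → Fin k → Fin m) (z : Fin m → Bool) (i j : Fin L) :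
    Decidable (Label T z i j) := by unfold Label; infer_instance

variable {T : Fin L → Fin k → Fin m} {z z' : Fin m → Bool} {i j i' j' : Fin L}

theorem Label.compl (h : Label T z i j) : Label T zᶜ j i :=
  ⟨h.2, by rw [compl_compl]; exact h.1⟩

theorem Label.unique (h : Label T z i j) (h' : Label T z i' j') : i = i' ∧ j = j' :=
  ⟨(h'.1 i).1 ((h.1 i).2 rfl), (h'.2 j).1 ((h.2 j).2 rfl)⟩

theorem Label.ne (hk : 0 < k) (h : Label T z i j) : i ≠ j := by
  rintro rfl
  exact not_sat_compl_of_sat hk ((h.1 i).2 rfl) ((h.2 i).2 rfl)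

/-- Terms are monotone and disjointness means `z ≤ z'ᶜ` and `z' ≤ zᶜ`; the uniqueness clauses then
identify the terms. This is what makes the yes functions intersecting. -/
theorem Label.of_disjoint (h : Label T z i j) (h' : Label T z' i' j') (hz : Disjoint z z') :
    i' = j ∧ j' = i := by
  have h1 : z ≤ z'ᶜ := le_compl_iff_disjoint_right.2 hz
  have h2 : z' ≤ zᶜ := le_compl_iff_disjoint_left.2 hz
  exact ⟨(h.2 i').1 (((h'.1 i').2 rfl).mono h2), ((h'.2 i).1 (((h.1 i).2 rfl).mono h1)).symm⟩

theorem card_terms : Fintype.card (Fin L → Fin k → Fin m) = (m ^ k) ^ L := by simp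

/-- Union bound over the `L` terms; repetitions within a term are allowed, so its `k` coordinates
are independent. -/
theorem card_exists_sat_le (hm : 0 < m) (z : Fin m → Bool) :
    ((Finset.univ.filter fun T : Fin L → Fin k → Fin m => ∃ i, Sat (T i) z).card : ℝ) ≤
      Fintype.card (Fin L → Fin k → Fin m) * (L * ((weight z : ℝ) / m) ^ k) := by
  classical
  have hone : ∀ i : Fin L, (Finset.univ.filter fun T : Fin L → Fin k → Fin m => Sat (T i) z).card =
      weight z ^ k * (m ^ k) ^ (L - 1) := by
    intro i
    have : (Finset.univ.filter fun T : Fin L → Fin k → Fin m => Sat (T i) z) =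
        Fintype.piFinset (Function.update (fun _ : Fin L => (Finset.univ : Finset (Fin k → Fin m)))
          i (Finset.univ.filter fun t => Sat t z)) := by
      ext T
      simp only [Finset.mem_filter, Finset.mem_univ, true_and, Fintype.mem_piFinset]
      constructor
      · intro h l
        by_cases hl : l = i
        · subst hl; simpa using h
        · simp [hl]
      · intro h
        simpa using h i
    rw [this, Fintype.card_piFinset]
    simp_rw [Function.apply_update (fun _ s => Finset.card s)]
    rw [Finset.prod_update_of_mem (Finset.mem_univ i), card_sat]
    simp [Finset.card_sdiff]
  have hsub : (Finset.univ.filter fun T : Fin L → Fin k → Fin m => ∃ i, Sat (T i) z) ⊆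
      Finset.univ.biUnion fun i => Finset.univ.filter fun T => Sat (T i) z := by
    intro T; simp
  have h1 := (Finset.card_le_card hsub).trans Finset.card_biUnion_le
  rw [Finset.sum_congr rfl fun i _ => hone i, Finset.sum_const, Finset.card_univ,
    Fintype.card_fin, smul_eq_mul] at h1
  rw [card_terms]
  have h2 : ((Finset.univ.filter fun T : Fin L → Fin k → Fin m => ∃ i, Sat (T i) z).card : ℝ) ≤
    L * (weight z ^ k * (m ^ k) ^ (L - 1)) := by exact_mod_cast h1
  refine h2.trans (le_of_eq ?_)
  have hm' : (m : ℝ) ≠ 0 := by positivity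
  rcases Nat.eq_zero_or_pos L with rfl | hL
  · simp
  · obtain ⟨L, rfl⟩ : ∃ L', L = L' + 1 := ⟨L - 1, by omega⟩
    push_cast
    rw [div_pow, pow_succ]
    field_simp

end Terms

/-! ### The hard functions: intersecting, far, and indistinguishable without collisions. -/

section HardFunctions
variable {n a m k L : ℕ}

/-- The weight of `z` is within `w` of `h`. -/
def InWindow (h w : ℕ) (z : Fin m → Bool) : Prop := h ≤ weight z + w ∧ weight z ≤ h + w

instance (h w : ℕ) (z : Fin m → Bool) : Decidable (InWindow h w z) := by
  unfold InWindow; infer_instance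

/-- The weight of `u` is smaller than half the dimension by at least `t / 2`. -/
def Low (t : ℕ) (u : Fin a → Bool) : Prop := 2 * weight u + t ≤ a

/-- The weight of `u` is larger than half the dimension by at least `t / 2`. -/
def High (t : ℕ) (u : Fin a → Bool) : Prop := a + t ≤ 2 * weight u

instance (t : ℕ) (u : Fin a → Bool) : Decidable (Low t u) := by unfold Low; infer_instance

instance (t : ℕ) (u : Fin a → Bool) : Decidable (High t u) := by unfold High; infer_instance

theorem InWindow.compl {h w : ℕ} {z : Fin (2 * h) → Bool} (hz : InWindow h w z) :
    InWindow h w zᶜ := by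
  have := weight_add_weight_compl z
  rw [Fintype.card_fin] at this
  unfold InWindow at *
  omega

theorem high_compl_iff {t : ℕ} {u : Fin a → Bool} : High t uᶜ ↔ Low t u := by
  have := weight_add_weight_compl u
  rw [Fintype.card_fin] at this
  unfold High Low
  omega

theorem low_compl_iff {t : ℕ} {u : Fin a → Bool} : Low t uᶜ ↔ High t u := by
  rw [← high_compl_iff, compl_compl]

theorem High.not_low {t : ℕ} (ht : 0 < t) {u : Fin a → Bool} (hu : High t u) : ¬ Low t u := by
  unfold High at hu
  unfold Low
  omega

theorem le_hammingDist_of_low_of_high {t : ℕ} {u v : Fin a → Bool} (hu : Low t u)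
    (hv : High t v) : t ≤ hammingDist u v := by
  have := weight_le_add_hammingDist v u
  rw [hammingDist_comm] at this
  unfold Low at hu
  unfold High at hv
  omega

/-- An unordered pair of indices, encoded by its sorted representative. -/
def pairIndex (i j : Fin L) : Fin L × Fin L := (min i j, max i j)

theorem pairIndex_comm (i j : Fin L) : pairIndex i j = pairIndex j i := by
  simp [pairIndex, min_comm, max_comm]

theorem pairIndex_eq_iff {i j i' j' : Fin L} :
    pairIndex i j = pairIndex i' j' ↔ (i = i' ∧ j = j') ∨ (i = j' ∧ j = i') := by
  constructor
  · intro h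
    simp only [pairIndex, Prod.mk.injEq] at h
    grind
  · rintro (⟨rfl, rfl⟩ | ⟨rfl, rfl⟩)
    · rfl
    · exact pairIndex_comm _ _

/-- Split a point of the cube into its action part and its control part. -/
def cubeSplit (e : Fin a ⊕ Fin m ≃ Fin n) : Cube n ≃ (Fin a → Bool) × (Fin m → Bool) :=
  (Equiv.arrowCongr e.symm (Equiv.refl Bool)).trans (Equiv.sumArrowEquivProdArrow _ _ _)

theorem cubeSplit_symm_inl (e : Fin a ⊕ Fin m ≃ Fin n) (u : Fin a → Bool) (z : Fin m → Bool)
    (i : Fin a) : (cubeSplit e).symm (u, z) (e (Sum.inl i)) = u i :=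
  congrFun (congrArg Prod.fst ((cubeSplit e).apply_symm_apply (u, z))) i

theorem cubeSplit_symm_inr (e : Fin a ⊕ Fin m ≃ Fin n) (u : Fin a → Bool) (z : Fin m → Bool)
    (i : Fin m) : (cubeSplit e).symm (u, z) (e (Sum.inr i)) = z i :=
  congrFun (congrArg Prod.snd ((cubeSplit e).apply_symm_apply (u, z))) i

theorem cubeSplit_compl (e : Fin a ⊕ Fin m ≃ Fin n) (x : Cube n) :
    cubeSplit e xᶜ = ((cubeSplit e x).1ᶜ, (cubeSplit e x).2ᶜ) := rfl

theorem disjoint_iff_forall_not {ι : Type*} {x y : ι → Bool} :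
    Disjoint x y ↔ ∀ i, ¬ (x i = true ∧ y i = true) := by
  rw [Pi.disjoint_iff]
  refine forall_congr' fun i => ?_
  cases x i <;> cases y i <;> simp [disjoint_iff]

theorem exists_both_true_of_not_disjoint (e : Fin a ⊕ Fin m ≃ Fin n) {x y : Cube n}
    (h : ¬ (Disjoint (cubeSplit e x).1 (cubeSplit e y).1 ∧
      Disjoint (cubeSplit e x).2 (cubeSplit e y).2)) :
    ∃ i, x i = true ∧ y i = true := by
  by_contra hne
  push Not at hne
  refine h ⟨disjoint_iff_forall_not.2 fun i hi => ?_, disjoint_iff_forall_not.2 fun i hi => ?_⟩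
  · exact hne _ hi.1 hi.2
  · exact hne _ hi.1 hi.2

/-- The parameters that define the hard functions, apart from the random ones. -/
structure HardParams where
  /-- the centre of the weight window of the control part -/
  mid : ℕ
  /-- the radius of the weight window of the control part -/
  width : ℕ
  /-- the gap between low and high action parts -/
  gap : ℕ

/-- A bit for each unordered pair of terms, possibly flipped, is the value of the hard function at
points with that label. Outside the weight window and at medium action parts the value is `0`. -/
def hardFun (p : HardParams) (e : Fin a ⊕ Fin m ≃ Fin n) (T : Fin L → Fin k → Fin m)
    (flip : (Fin a → Bool) → Fin L → Fin L → Bool) (β : Fin L × Fin L → Bool) : BoolFun n :=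
  fun x => decide ((Low p.gap (cubeSplit e x).1 ∨ High p.gap (cubeSplit e x).1) ∧
    InWindow p.mid p.width (cubeSplit e x).2 ∧
    ∃ i j, Label T (cubeSplit e x).2 i j ∧ β (pairIndex i j) ≠ flip (cubeSplit e x).1 i j)

/-- The flips of the intersecting hard functions. -/
def yesFlip (_ : Fin a → Bool) (i j : Fin L) : Bool := decide (i < j)

/-- The flips of the hard functions far from intersecting. -/
def noFlip (t : ℕ) (u : Fin a → Bool) (_ _ : Fin L) : Bool := decide (Low t u)

theorem isIntersecting_hardFun (hk : 0 < k) (p : HardParams) (e : Fin a ⊕ Fin m ≃ Fin n)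
    (T : Fin L → Fin k → Fin m) (β : Fin L × Fin L → Bool) :
    IsIntersecting (hardFun p e T yesFlip β) := by
  intro x y hx hy
  simp only [hardFun, decide_eq_true_eq] at hx hy
  obtain ⟨-, -, i, j, hl, hb⟩ := hx
  obtain ⟨-, -, i', j', hl', hb'⟩ := hy
  refine exists_both_true_of_not_disjoint e fun hd => ?_
  obtain ⟨rfl, rfl⟩ := hl.of_disjoint hl' hd.2
  rw [pairIndex_comm] at hb'
  have hne := hl.ne hk
  simp only [yesFlip] at hb hb'
  rcases lt_or_gt_of_ne hne with h | h
  · have h' := h.le.not_gt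
    simp_all
  · have h' := h.le.not_gt
    simp_all

/-- The control parts at which the far hard function is `1` on all low action parts. -/
def activeControls (p : HardParams) (T : Fin L → Fin k → Fin m) (β : Fin L × Fin L → Bool) :
    Finset (Fin m → Bool) :=
  Finset.univ.filter fun z => InWindow p.mid p.width z ∧
    ∃ i j, Label T z i j ∧ β (pairIndex i j) = false

/-- The number of low points. -/
def lowCount (a t : ℕ) : ℕ := (Finset.univ.filter fun u : Fin a → Bool => Low t u).card

/-- Low points form a union of layers of weight at most half the dimension, so
`choose_le_card_add_card` applies layer by layer. -/
theorem lowCount_le_card_add_card (t : ℕ) (S S' : Finset (Fin a → Bool))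
    (h : ∀ u v : Fin a → Bool, Low t u → Low t v → Disjoint u v → u ∈ S ∨ v ∈ S') :
    lowCount a t ≤ S.card + S'.card := by
  have hfib : ∀ R : Finset (Fin a → Bool), R.card =
      ∑ k ∈ Finset.range (a + 1), (R.filter fun u => weight u = k).card := fun R =>
    Finset.card_eq_sum_card_fiberwise fun u _ => by
      have := weight_add_weight_compl u
      rw [Fintype.card_fin] at this
      simp only [Finset.coe_range, Set.mem_Iio]
      omega
  rw [lowCount, hfib, hfib S, hfib S', ← Finset.sum_add_distrib]
  refine Finset.sum_le_sum fun k _ => ?_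
  by_cases hk : 2 * k + t ≤ a
  · have h1 := choose_le_card_add_card S S' (k := k) (by rw [Fintype.card_fin]; omega)
      fun u v hu hv huv => h u v (by unfold Low; omega) (by unfold Low; omega) huv
    refine le_trans ?_ h1
    rw [← card_weight_eq]
    exact Finset.card_le_card fun u => by simp
  · rw [Finset.filter_filter, Finset.card_eq_zero.2]
    · exact Nat.zero_le _
    · rw [Finset.filter_eq_empty_iff]
      rintro u - ⟨hu, rfl⟩
      exact hk hu

/-- For disjoint low `u`, `v` the points `(u, z)` and `(v, zᶜ)` are disjoint, so `g` vanishes at one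
of them. The zeros of `g` over `z` and `zᶜ` thus form a cover of the disjoint low pairs.
Complementation preserves the active controls, so summing over them counts each modified point
twice. -/
theorem card_activeControls_mul_lowCount_le {p : HardParams} {e : Fin a ⊕ Fin (2 * p.mid) ≃ Fin n}
    {T : Fin L → Fin k → Fin (2 * p.mid)} {β : Fin L × Fin L → Bool} {g : BoolFun n}
    (hg : IsIntersecting g) :
    (activeControls p T β).card * lowCount a p.gap ≤
      2 * (Finset.univ.filter fun x => hardFun p e T (noFlip p.gap) β x ≠ g x).card := by
  set f := hardFun p e T (noFlip p.gap) β with hf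
  set s : (Fin (2 * p.mid) → Bool) → Finset (Fin a → Bool) := fun z =>
    Finset.univ.filter fun u => Low p.gap u ∧ g ((cubeSplit e).symm (u, z)) = false with hs
  have hcompl : ∀ z ∈ activeControls p T β, zᶜ ∈ activeControls p T β := by
    intro z hz
    simp only [activeControls, Finset.mem_filter, Finset.mem_univ, true_and] at hz ⊢
    obtain ⟨hw, i, j, hl, hb⟩ := hz
    exact ⟨hw.compl, j, i, hl.compl, by rw [pairIndex_comm]; exact hb⟩
  have h1 : ∀ z, lowCount a p.gap ≤ (s z).card + (s zᶜ).card := by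
    intro z
    refine lowCount_le_card_add_card p.gap _ _ fun u v hu hv huv => ?_
    · by_contra hcon
      simp only [hs, Finset.mem_filter, Finset.mem_univ, true_and, hu, hv, not_or,
        Bool.not_eq_false] at hcon
      obtain ⟨i, hi⟩ := hg _ _ hcon.1 hcon.2
      obtain ⟨i, rfl⟩ := e.surjective i
      rcases i with i | i
      · rw [cubeSplit_symm_inl, cubeSplit_symm_inl] at hi
        exact disjoint_iff_forall_not.1 huv i hi
      · rw [cubeSplit_symm_inr, cubeSplit_symm_inr] at hi
        exact disjoint_iff_forall_not.1 (disjoint_compl_right (a := z)) i hi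
  have h2 : ∑ z ∈ activeControls p T β, (s zᶜ).card = ∑ z ∈ activeControls p T β, (s z).card :=
    Finset.sum_bij' (fun z _ => zᶜ) (fun z _ => zᶜ) hcompl hcompl (by simp) (by simp) (by simp)
  have h3 : ∑ z ∈ activeControls p T β, (s z).card ≤
      (Finset.univ.filter fun x => f x ≠ g x).card := by
    rw [← Finset.card_sigma]
    refine Finset.card_le_card_of_injOn (fun q => (cubeSplit e).symm (q.2, q.1)) ?_ ?_
    · rintro ⟨z, u⟩ hzu
      simp only [Finset.coe_sigma, Set.mem_sigma_iff, Finset.mem_coe, hs, Finset.mem_filter,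
        Finset.mem_univ, true_and, activeControls] at hzu
      obtain ⟨⟨hw, i, j, hl, hb⟩, hu, hgf⟩ := hzu
      simp only [Finset.coe_filter, Finset.mem_univ, true_and, Set.mem_ofPred_eq, hgf]
      rw [hf]
      simp only [hardFun, Equiv.apply_symm_apply, ne_eq, decide_eq_false_iff_not, not_not]
      exact ⟨Or.inl hu, hw, i, j, hl, by simp [noFlip, hu, hb]⟩
    · rintro ⟨z, u⟩ - ⟨z', u'⟩ - h
      have := (cubeSplit e).symm.injective h
      simp only [Prod.mk.injEq] at this
      obtain ⟨rfl, rfl⟩ := this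
      rfl
  calc (activeControls p T β).card * lowCount a p.gap
      = ∑ z ∈ activeControls p T β, lowCount a p.gap := by simp
    _ ≤ ∑ z ∈ activeControls p T β, ((s z).card + (s zᶜ).card) :=
        Finset.sum_le_sum fun z _ => h1 z
    _ = 2 * ∑ z ∈ activeControls p T β, (s z).card := by
        rw [Finset.sum_add_distrib, h2]; ring
    _ ≤ _ := Nat.mul_le_mul_left 2 h3

/-- Two points in the weight window share a satisfied term although their action parts are far
apart. -/
def Collide (p : HardParams) (e : Fin a ⊕ Fin m ≃ Fin n) (T : Fin L → Fin k → Fin m)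
    (x y : Cube n) : Prop :=
  InWindow p.mid p.width (cubeSplit e x).2 ∧ InWindow p.mid p.width (cubeSplit e y).2 ∧
    (∃ i, Sat (T i) ((cubeSplit e x).2 ⊓ (cubeSplit e y).2)) ∧
    p.gap ≤ hammingDist (cubeSplit e x).1 (cubeSplit e y).1

/-- The bit of a pair is toggled exactly when the yes flip and the no flip disagree at a query
carrying that pair. Absence of collisions makes this choice independent of the query, and toggling
fixed bits permutes the assignments. -/
theorem exists_perm_hardFun_eq {q : ℕ} (hk : 0 < k) {p : HardParams} (hp : 0 < p.gap)
    {e : Fin a ⊕ Fin (2 * p.mid) ≃ Fin n} {T : Fin L → Fin k → Fin (2 * p.mid)}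
    (Q : Fin q → Cube n)
    (hQ : ∀ b c, ¬ Collide p e T (Q b) (Q c) ∧ ¬ Collide p e T (Q b) (Q c)ᶜ) :
    ∃ φ : Equiv.Perm (Fin L × Fin L → Bool), ∀ β b,
      hardFun p e T yesFlip β (Q b) = hardFun p e T (noFlip p.gap) (φ β) (Q b) := by
  classical
  set Rel : Fin q → Fin L → Fin L → Prop := fun b i j =>
    (Low p.gap (cubeSplit e (Q b)).1 ∨ High p.gap (cubeSplit e (Q b)).1) ∧
    InWindow p.mid p.width (cubeSplit e (Q b)).2 ∧ Label T (cubeSplit e (Q b)).2 i j with hRel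
  set ψ : Fin L × Fin L → Bool := fun c => decide (∃ b i j, Rel b i j ∧ pairIndex i j = c ∧
    decide (i < j) ≠ decide (Low p.gap (cubeSplit e (Q b)).1)) with hψ
  have hψ_eq : ∀ b i j, Rel b i j → ψ (pairIndex i j) =
      xor (decide (i < j)) (decide (Low p.gap (cubeSplit e (Q b)).1)) := by
    intro b i j hb
    by_cases hne : decide (i < j) = decide (Low p.gap (cubeSplit e (Q b)).1)
    · rw [hne, Bool.xor_self, hψ, decide_eq_false_iff_not]
      rintro ⟨c, i', j', hc, hij, hne'⟩
      obtain ⟨hbu, hbw, hbl⟩ := hb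
      obtain ⟨hcu, hcw, hcl⟩ := hc
      rcases pairIndex_eq_iff.1 hij with ⟨rfl, rfl⟩ | ⟨rfl, rfl⟩
      -- Equal ordered labels: the yes flips agree, so the conflict puts one action part low and the
      -- other high, and the two queries collide.
      · refine (hQ b c).1 ⟨hbw, hcw, ⟨i', sat_inf.2 ⟨(hbl.1 _).2 rfl, (hcl.1 _).2 rfl⟩⟩, ?_⟩
        rw [hne] at hne'
        rcases hbu with hbu | hbu <;> rcases hcu with hcu | hcu
        · simp [hbu, hcu] at hne'
        · exact le_hammingDist_of_low_of_high hbu hcu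
        · rw [hammingDist_comm]
          exact le_hammingDist_of_low_of_high hcu hbu
        · simp [hbu.not_low hp, hcu.not_low hp] at hne'
      -- Swapped labels: the yes flips differ, so in a conflict both action parts are low or both
      -- are high. Then query `b` collides with the complement of query `c`.
      · refine (hQ b c).2 ⟨hbw, hcw.compl,
          ⟨j', sat_inf.2 ⟨(hbl.1 _).2 rfl, (hcl.2 _).2 rfl⟩⟩, ?_⟩
        have hlt : decide (j' < i') = !decide (i' < j') := by
          rcases lt_or_gt_of_ne (hcl.ne hk) with h | h
          · simp [h, h.le.not_gt]
          · simp [h, h.le.not_gt]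
        rw [hlt] at hne
        rw [cubeSplit_compl]
        rcases hbu with hbu | hbu <;> rcases hcu with hcu | hcu
        · exact le_hammingDist_of_low_of_high hbu (high_compl_iff.2 hcu)
        · simp [hbu, hcu.not_low hp] at hne hne'
          exact absurd hne' (not_lt.2 hne)
        · simp [hcu, hbu.not_low hp] at hne hne'
          exact absurd hne (not_lt.2 hne')
        · rw [hammingDist_comm]
          exact le_hammingDist_of_low_of_high (low_compl_iff.2 hcu) hbu
    · have : ψ (pairIndex i j) = true := by
        rw [hψ, decide_eq_true_eq]
        exact ⟨b, i, j, hb, rfl, hne⟩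
      rw [this, eq_comm, Bool.xor_iff_ne]
      exact hne
  have hinv : Function.Involutive fun (β : Fin L × Fin L → Bool) c => xor (β c) (ψ c) := by
    intro β
    ext c
    simp
  refine ⟨hinv.toPerm, fun β b => ?_⟩
  unfold hardFun
  rw [decide_eq_decide]
  refine and_congr_right fun hu => and_congr_right fun hw => ?_
  refine exists_congr fun i => exists_congr fun j => and_congr_right fun hl => ?_
  rw [Function.Involutive.coe_toPerm, hψ_eq b i j ⟨hu, hw, hl⟩]
  simp only [yesFlip, noFlip]
  cases β (pairIndex i j) <;> cases decide (i < j) <;>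
    cases decide (Low p.gap (cubeSplit e (Q b)).1) <;> simp

end HardFunctions

/-! ### Chebyshev's inequality for repeated random bits. -/

section SecondMoment

theorem sum_sign_mul_sign {C : Type*} [Fintype C] [DecidableEq C] {c c' : C} (h : c ≠ c') :
    ∑ β : C → Bool, (if β c = true then (1 : ℝ) else -1) * (if β c' = true then 1 else -1) = 0 := by
  refine Finset.sum_involution (fun β _ => Function.update β c (!β c)) ?_ ?_ (by simp) ?_
  · intro β _
    simp only [Function.update_self, Function.update_of_ne h.symm]
    cases β c <;> cases β c' <;> simp
  · intro β _ _ heq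
    have := congrFun heq c
    simp at this
  · intro β _
    simp

/-- Chebyshev's inequality for a sum of random bits in which bits are repeated. -/
theorem card_few_false_mul_le {C ζ : Type*} [Fintype C] [DecidableEq C] (Z : Finset ζ) (c : ζ → C) :
    ((Finset.univ.filter fun β : C → Bool =>
        4 * (Z.filter fun z => β (c z) = false).card < Z.card).card : ℝ) * (Z.card : ℝ) ^ 2 ≤
      4 * ((Z ×ˢ Z).filter fun q => c q.1 = c q.2).card * Fintype.card (C → Bool) := by
  set σ : (C → Bool) → ζ → ℝ := fun β z => if β (c z) = true then 1 else -1 with hσ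
  -- Signs of distinct bits are orthogonal, so only pairs that use the same bit contribute.
  have h1 : ∑ β : C → Bool, (∑ z ∈ Z, σ β z) ^ 2 =
      ((Z ×ˢ Z).filter fun q => c q.1 = c q.2).card * Fintype.card (C → Bool) := by
    simp_rw [sq, Finset.sum_mul_sum]
    rw [Finset.sum_comm]
    simp_rw [fun z => Finset.sum_comm (s := (Finset.univ : Finset (C → Bool))) (t := Z)
      (f := fun β z' => σ β z * σ β z')]
    rw [← Finset.sum_product', Finset.card_filter, Nat.cast_sum, Finset.sum_mul]
    refine Finset.sum_congr rfl fun q _ => ?_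
    by_cases hq : c q.1 = c q.2
    · have : ∀ β : C → Bool, σ β q.1 * σ β q.2 = 1 := by
        intro β
        simp only [hσ, hq]
        split_ifs <;> norm_num
      simp [this, hq]
    · simp only [hq, if_false]
      rw [Nat.cast_zero, zero_mul]
      exact sum_sign_mul_sign hq
  -- The sign sum is `|Z|` minus twice the number of false bits; if fewer than a quarter are false
  -- it exceeds `|Z| / 2`.
  have h2 : ∀ β ∈ Finset.univ.filter fun β : C → Bool =>
        4 * (Z.filter fun z => β (c z) = false).card < Z.card,
      (Z.card : ℝ) ^ 2 ≤ 4 * (∑ z ∈ Z, σ β z) ^ 2 := by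
    intro β hβ
    have hβ := (Finset.mem_filter.1 hβ).2
    have hs : ∑ z ∈ Z, σ β z = Z.card - 2 * (Z.filter fun z => β (c z) = false).card := by
      have : ∀ z, σ β z = 1 - 2 * (if β (c z) = false then 1 else 0) := by
        intro z
        simp only [hσ]
        cases β (c z) <;> norm_num
      simp_rw [this]
      rw [Finset.sum_sub_distrib, ← Finset.mul_sum, Finset.sum_boole]
      simp
    have hβ' : 4 * ((Z.filter fun z => β (c z) = false).card : ℝ) < Z.card := by exact_mod_cast hβ
    have h0 : (0 : ℝ) ≤ (Z.filter fun z => β (c z) = false).card := Nat.cast_nonneg _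
    rw [hs]
    nlinarith
  calc _ = ∑ β ∈ Finset.univ.filter fun β : C → Bool =>
        4 * (Z.filter fun z => β (c z) = false).card < Z.card, (Z.card : ℝ) ^ 2 := by
        rw [Finset.sum_const, nsmul_eq_mul]
    _ ≤ ∑ β ∈ Finset.univ.filter fun β : C → Bool =>
        4 * (Z.filter fun z => β (c z) = false).card < Z.card, 4 * (∑ z ∈ Z, σ β z) ^ 2 :=
        Finset.sum_le_sum h2
    _ ≤ ∑ β : C → Bool, 4 * (∑ z ∈ Z, σ β z) ^ 2 :=
        Finset.sum_le_sum_of_subset_of_nonneg (Finset.subset_univ _) fun _ _ _ => by positivity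
    _ = _ := by rw [← Finset.mul_sum, h1, mul_assoc]

end SecondMoment

/-! ### Counting the term families that label a given point. -/

section Labelled
variable {L k m : ℕ}

-- It suffices that term `i` is satisfied by `z`, term `j` by `zᶜ`, and every other term by neither.
-- These conditions are independent, and the first two exclude each other because `k > 0`.
open Classical in
theorem card_label_ge (hk : 0 < k) (z : Fin m → Bool) {i j : Fin L} (hij : i ≠ j) :
    weight z ^ k * weight zᶜ ^ k * (m ^ k - weight z ^ k - weight zᶜ ^ k) ^ (L - 2) ≤
      (Finset.univ.filter fun T : Fin L → Fin k → Fin m => Label T z i j).card := by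
  set S := Finset.univ.filter fun t : Fin k → Fin m => Sat t z with hS
  set S' := Finset.univ.filter fun t : Fin k → Fin m => Sat t zᶜ with hS'
  set R : Fin L → Finset (Fin k → Fin m) := fun l => if l = i then S else if l = j then S' else
    (Finset.univ \ S) \ S' with hR
  have hsub : Fintype.piFinset R ⊆
      Finset.univ.filter fun T : Fin L → Fin k → Fin m => Label T z i j := by
    intro T hT
    rw [Fintype.mem_piFinset] at hT
    refine Finset.mem_filter.2 ⟨Finset.mem_univ _, fun l => ?_, fun l => ?_⟩
    · have hl := hT l
      simp only [hR] at hl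
      split_ifs at hl with h1 h2
      · simp only [h1, iff_true]
        rw [h1] at hl
        exact (Finset.mem_filter.1 hl).2
      · simp only [h1, iff_false]
        intro h
        exact not_sat_compl_of_sat hk h (Finset.mem_filter.1 hl).2
      · simp only [h1, iff_false]
        simp [hS, hS'] at hl
        exact hl.1
    · have hl := hT l
      simp only [hR] at hl
      split_ifs at hl with h1 h2
      · have : l ≠ j := h1 ▸ hij
        simp only [this, iff_false]
        exact not_sat_compl_of_sat hk (Finset.mem_filter.1 hl).2
      · simp only [h2, iff_true]
        rw [h2] at hl
        exact (Finset.mem_filter.1 hl).2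
      · simp only [h2, iff_false]
        simp [hS, hS'] at hl
        exact hl.2
  refine le_trans ?_ (Finset.card_le_card hsub)
  rw [Fintype.card_piFinset, ← Finset.mul_prod_erase _ _ (Finset.mem_univ i),
    ← Finset.mul_prod_erase _ _ (Finset.mem_erase.2 ⟨hij.symm, Finset.mem_univ j⟩), ← mul_assoc]
  have e1 : (R i).card = weight z ^ k := by simp only [hR, if_true]; exact card_sat z
  have e2 : (R j).card = weight zᶜ ^ k := by
    simp only [hR, if_neg hij.symm, if_true]; exact card_sat zᶜ
  rw [e1, e2]
  refine Nat.mul_le_mul_left _ ?_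
  have e3 : ∀ l ∈ (Finset.univ.erase i).erase j,
      (R l).card ≥ m ^ k - weight z ^ k - weight zᶜ ^ k := by
    intro l hl
    simp only [Finset.mem_erase, Finset.mem_univ, and_true] at hl
    simp only [hR, if_neg hl.1, if_neg hl.2]
    have h1 := Finset.le_card_sdiff S (Finset.univ : Finset (Fin k → Fin m))
    have h2 := Finset.le_card_sdiff S' (Finset.univ \ S)
    have hc : S.card = weight z ^ k := card_sat z
    have hc' : S'.card = weight zᶜ ^ k := card_sat zᶜ
    have hu : (Finset.univ : Finset (Fin k → Fin m)).card = m ^ k := by simp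
    omega
  have e4 : ((Finset.univ.erase i).erase j).card = L - 2 := by
    rw [Finset.card_erase_of_mem (Finset.mem_erase.2 ⟨hij.symm, Finset.mem_univ j⟩),
      Finset.card_erase_of_mem (Finset.mem_univ i), Finset.card_univ, Fintype.card_fin]
    omega
  rw [← e4, ← Finset.prod_const]
  exact Finset.prod_le_prod' e3

/-- Labels are unique, so the events for the `L (L - 1)` ordered pairs are disjoint and their counts
add up. -/
theorem card_exists_label_ge (hk : 0 < k) (hm : 0 < m) (hL : 2 ≤ L) (z : Fin m → Bool)
    (hz : ((weight z : ℝ) / m) ^ k + ((weight zᶜ : ℝ) / m) ^ k ≤ 1) :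
    Fintype.card (Fin L → Fin k → Fin m) *
      (L * (L - 1) * (((weight z : ℝ) / m) ^ k * ((weight zᶜ : ℝ) / m) ^ k) *
        (1 - ((weight z : ℝ) / m) ^ k - ((weight zᶜ : ℝ) / m) ^ k) ^ (L - 2)) ≤
      (Finset.univ.filter fun T : Fin L → Fin k → Fin m => ∃ i j, Label T z i j).card := by
  classical
  set v := weight z ^ k * weight zᶜ ^ k * (m ^ k - weight z ^ k - weight zᶜ ^ k) ^ (L - 2) with hv
  have h1 : L * (L - 1) * v ≤
      (Finset.univ.filter fun T : Fin L → Fin k → Fin m => ∃ i j, Label T z i j).card := by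
    have hsub : (Finset.univ : Finset (Fin L)).offDiag.biUnion (fun q => Finset.univ.filter
        fun T : Fin L → Fin k → Fin m => Label T z q.1 q.2) ⊆
        Finset.univ.filter fun T : Fin L → Fin k → Fin m => ∃ i j, Label T z i j := by
      intro T hT
      simp only [Finset.mem_biUnion, Finset.mem_filter, Finset.mem_univ, true_and] at hT ⊢
      obtain ⟨q, -, hq⟩ := hT
      exact ⟨_, _, hq⟩
    refine le_trans ?_ (Finset.card_le_card hsub)
    rw [Finset.card_biUnion]
    · have : L * (L - 1) = (Finset.univ : Finset (Fin L)).offDiag.card := by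
        rw [Finset.offDiag_card, Finset.card_univ, Fintype.card_fin, Nat.mul_sub, mul_one]
      rw [this, ← smul_eq_mul, ← Finset.sum_const]
      refine Finset.sum_le_sum fun q hq => ?_
      exact card_label_ge hk z (Finset.mem_offDiag.1 hq).2.2
    · intro q _ q' _ hne
      rw [Function.onFun, Finset.disjoint_filter]
      intro T _ h h'
      exact hne (Prod.ext (h.unique h').1 (h.unique h').2)
  have h2 : (L * (L - 1) * v : ℝ) ≤
      (Finset.univ.filter fun T : Fin L → Fin k → Fin m => ∃ i j, Label T z i j).card := by
    have := (Nat.cast_le (α := ℝ)).2 h1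
    rwa [Nat.cast_mul, Nat.cast_mul, Nat.cast_pred (by omega)] at this
  refine le_trans (le_of_eq ?_) h2
  have hmk : (0 : ℝ) < (m : ℝ) ^ k := by positivity
  have hz' : weight z ^ k + weight zᶜ ^ k ≤ m ^ k := by
    rw [div_pow, div_pow, ← add_div, div_le_one hmk] at hz
    exact_mod_cast hz
  have hvr : (v : ℝ) = (weight z : ℝ) ^ k * (weight zᶜ : ℝ) ^ k *
      ((m : ℝ) ^ k - (weight z : ℝ) ^ k - (weight zᶜ : ℝ) ^ k) ^ (L - 2) := by
    rw [hv, Nat.sub_sub]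
    push_cast [Nat.cast_sub hz']
    ring
  rw [hvr, card_terms]
  obtain ⟨L, rfl⟩ : ∃ L', L = L' + 2 := ⟨L - 2, by omega⟩
  have e : 1 - ((weight z : ℝ) / m) ^ k - ((weight zᶜ : ℝ) / m) ^ k =
      ((m : ℝ) ^ k - (weight z : ℝ) ^ k - (weight zᶜ : ℝ) ^ k) / (m : ℝ) ^ k := by
    rw [div_pow, div_pow]
    field_simp
  rw [e, show L + 2 - 2 = L by omega, div_pow, div_pow, div_pow]
  push_cast
  field_simp
  ring

theorem sum_exp_neg_hammingDist (z : Fin m → Bool) (r : ℝ) :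
    ∑ z' : Fin m → Bool, Real.exp (r * hammingDist z z') = (1 + Real.exp r) ^ m := by
  have h : ∀ z' : Fin m → Bool, Real.exp (r * hammingDist z z') =
      ∏ i, if z i ≠ z' i then Real.exp r else 1 := by
    intro z'
    rw [hammingDist_eq_sum, Nat.cast_sum, Finset.mul_sum, Real.exp_sum]
    refine Finset.prod_congr rfl fun i _ => ?_
    split_ifs <;> simp
  simp_rw [h]
  have := Finset.prod_univ_sum (fun _ : Fin m => (Finset.univ : Finset Bool))
    (fun i b => if z i ≠ b then Real.exp r else 1)
  rw [Fintype.piFinset_univ] at this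
  rw [← this]
  have hb : ∀ i : Fin m, ∑ b : Bool, (if z i ≠ b then Real.exp r else 1) = 1 + Real.exp r := by
    intro i
    rw [Fintype.sum_bool]
    cases z i <;> simp [add_comm]
  rw [Finset.prod_congr rfl fun i _ => hb i]
  simp

end Labelled

/-! ### Averages over random terms: labelled points and pairs with the same label. -/

section RandomTerms
variable {L k : ℕ} {p : HardParams}

/-- The points in the weight window. -/
def window (p : HardParams) : Finset (Fin (2 * p.mid) → Bool) :=
  Finset.univ.filter fun z => InWindow p.mid p.width z

theorem mem_window {z : Fin (2 * p.mid) → Bool} : z ∈ window p ↔ InWindow p.mid p.width z := by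
  simp [window]

/-- The points in the weight window that have a label. -/
def labelled (p : HardParams) (T : Fin L → Fin k → Fin (2 * p.mid)) :
    Finset (Fin (2 * p.mid) → Bool) :=
  (window p).filter fun z => ∃ i j, Label T z i j

/-- The pairs of points in the weight window with the same unordered label. -/
def sharing (p : HardParams) (T : Fin L → Fin k → Fin (2 * p.mid)) :
    Finset ((Fin (2 * p.mid) → Bool) × (Fin (2 * p.mid) → Bool)) :=
  (window p ×ˢ window p).filter fun q => ∃ i j i' j', Label T q.1 i j ∧ Label T q.2 i' j' ∧
    pairIndex i j = pairIndex i' j'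

theorem card_few_active_mul_le (T : Fin L → Fin k → Fin (2 * p.mid)) :
    ((Finset.univ.filter fun β : Fin L × Fin L → Bool =>
      4 * (activeControls p T β).card < (labelled p T).card).card : ℝ) *
        ((labelled p T).card : ℝ) ^ 2 ≤
      4 * (sharing p T).card * Fintype.card (Fin L × Fin L → Bool) := by
  classical
  rcases (labelled p T).eq_empty_or_nonempty with h0 | ⟨z₀, hz₀⟩
  · simp only [h0, Finset.card_empty, Nat.cast_zero, ne_eq, OfNat.ofNat_ne_zero, not_false_eq_true,
      zero_pow, mul_zero]
    positivity
  obtain ⟨i₀, -⟩ := (Finset.mem_filter.1 hz₀).2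
  -- The default `(i₀, i₀)` is immaterial: `c` is only used on labelled points.
  set c : (Fin (2 * p.mid) → Bool) → Fin L × Fin L := fun z =>
    if h : ∃ i j, Label T z i j then pairIndex h.choose h.choose_spec.choose else (i₀, i₀) with hc
  have hcl : ∀ z i j, Label T z i j → c z = pairIndex i j := by
    intro z i j hl
    have h : ∃ i j, Label T z i j := ⟨i, j, hl⟩
    obtain ⟨h1, h2⟩ := h.choose_spec.choose_spec.unique hl
    simp only [hc, dif_pos h]
    rw [h2, h1]
  have hact : ∀ β : Fin L × Fin L → Bool,
      (labelled p T).filter (fun z => β (c z) = false) = activeControls p T β := by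
    intro β
    ext z
    simp only [labelled, window, activeControls, Finset.mem_filter, Finset.mem_univ, true_and,
      and_assoc]
    refine and_congr_right fun _ => ⟨?_, ?_⟩
    · rintro ⟨⟨i, j, hl⟩, hb⟩
      exact ⟨i, j, hl, hcl z i j hl ▸ hb⟩
    · rintro ⟨i, j, hl, hb⟩
      exact ⟨⟨i, j, hl⟩, (hcl z i j hl).symm ▸ hb⟩
  have hshare : ((labelled p T ×ˢ labelled p T).filter fun q => c q.1 = c q.2) ⊆ sharing p T := by
    rintro ⟨z, z'⟩ h
    simp only [labelled, sharing, Finset.mem_filter, Finset.mem_product] at h ⊢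
    obtain ⟨⟨⟨hw, i, j, hl⟩, hw', i', j', hl'⟩, he⟩ := h
    exact ⟨⟨hw, hw'⟩, i, j, i', j', hl, hl', by rw [← hcl z i j hl, ← hcl z' i' j' hl', he]⟩
  have h := card_few_false_mul_le (labelled p T) c
  simp_rw [hact] at h
  refine h.trans ?_
  gcongr

theorem exp_neg_two_mul_le_one_sub {x : ℝ} (h0 : 0 ≤ x) (h1 : x ≤ 1 / 2) :
    Real.exp (-(2 * x)) ≤ 1 - x := by
  have hpos : (0 : ℝ) < 1 - x := by linarith
  have h2 := Real.one_sub_inv_le_log_of_pos hpos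
  rw [← Real.le_log_iff_exp_le hpos]
  refine le_trans ?_ h2
  have h3 : (1 - x)⁻¹ ≤ 1 + 2 * x := by
    rw [inv_le_iff_one_le_mul₀ hpos]
    nlinarith
  linarith

/-- The window is narrow enough that a term behaves as at the middle weight. The first bound is `(1
+ width/mid)^k ≤ e`. For the second, the product of the densities of `z` and `zᶜ`, rescaled by `4`,
is `1 - (s/h)²`, and Bernoulli's inequality loses at most `k·width²/mid² ≤ 1/2`. -/
theorem InWindow.pow_bounds (hw : k * p.width ≤ p.mid) (h2w : 2 * p.width ≤ p.mid)
    (hh : 0 < p.mid) {z : Fin (2 * p.mid) → Bool}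
    (hz : InWindow p.mid p.width z) :
    2 ^ k * ((weight z : ℝ) / (2 * p.mid : ℕ)) ^ k ≤ Real.exp 1 ∧
    1 / 2 ≤ 2 ^ k * 2 ^ k * (((weight z : ℝ) / (2 * p.mid : ℕ)) ^ k *
      ((weight zᶜ : ℝ) / (2 * p.mid : ℕ)) ^ k) := by
  have hpos : 0 < (p.mid : ℝ) := by positivity
  have hkw : (k : ℝ) * p.width ≤ p.mid := by exact_mod_cast hw
  have hzw1 : (p.mid : ℝ) ≤ weight z + p.width := by exact_mod_cast hz.1
  have hzw2 : (weight z : ℝ) ≤ p.mid + p.width := by exact_mod_cast hz.2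
  have h2w' : 2 * (p.width : ℝ) ≤ p.mid := by exact_mod_cast h2w
  have hcomp : (weight z : ℝ) + weight zᶜ = 2 * p.mid := by
    have := weight_add_weight_compl z
    rw [Fintype.card_fin] at this
    exact_mod_cast this
  have e : ∀ v : ℝ, 2 ^ k * (v / (2 * p.mid : ℕ)) ^ k = (v / p.mid) ^ k := by
    intro v
    rw [← mul_pow]
    congr 1
    push_cast
    field_simp
  set h : ℝ := (p.mid : ℝ) with hh'
  constructor
  · rw [e]
    have h1 : (weight z : ℝ) / h ≤ Real.exp (p.width / h) := by
      refine le_trans ?_ (Real.add_one_le_exp _)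
      rw [div_add_one hpos.ne']
      gcongr
      linarith
    calc ((weight z : ℝ) / h) ^ k ≤ (Real.exp (p.width / h)) ^ k := by gcongr
      _ = Real.exp (k * (p.width / h)) := by rw [← Real.exp_nat_mul]
      _ ≤ Real.exp 1 := by
        rw [Real.exp_le_exp, mul_div_assoc', div_le_one hpos]
        exact hkw
  · rw [mul_mul_mul_comm, e, e, ← mul_pow]
    set s : ℝ := weight z - h with hs
    have h1 : (weight z : ℝ) / h * (weight zᶜ / h) = 1 + -(s / h) ^ 2 := by
      rw [show (weight zᶜ : ℝ) = h - s by linarith, show (weight z : ℝ) = h + s by linarith]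
      field_simp
      ring
    rw [h1]
    have hw0 : (0 : ℝ) ≤ p.width := Nat.cast_nonneg _
    have hsq : s ^ 2 ≤ p.width ^ 2 := sq_le_sq' (by linarith) (by linarith)
    have hsh : (s / h) ^ 2 ≤ p.width ^ 2 / h ^ 2 := by rw [div_pow]; gcongr
    have hwh : (p.width : ℝ) ^ 2 / h ^ 2 ≤ 1 := by
      rw [div_le_one (by positivity)]
      nlinarith
    refine le_trans ?_ (one_add_mul_le_pow (by linarith) k)
    have : (k : ℝ) * (p.width ^ 2 / h ^ 2) ≤ 1 / 2 := by
      rw [mul_div_assoc', div_le_iff₀ (by positivity)]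
      nlinarith
    have : (k : ℝ) * (s / h) ^ 2 ≤ 1 / 2 := le_trans (by gcongr) this
    linarith

theorem card_exists_label_ge_of_inWindow (hk : 4 ≤ k) (hw : k * p.width ≤ p.mid)
    (h2w : 2 * p.width ≤ p.mid) (hh : 0 < p.mid) {z : Fin (2 * p.mid) → Bool}
    (hz : InWindow p.mid p.width z) :
    Real.exp (-12) / 4 * Fintype.card (Fin (2 ^ k) → Fin k → Fin (2 * p.mid)) ≤
      (Finset.univ.filter fun T : Fin (2 ^ k) → Fin k → Fin (2 * p.mid) =>
        ∃ i j, Label T z i j).card := by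
  obtain ⟨b1, b2⟩ := hz.pow_bounds hw h2w hh
  obtain ⟨b3, -⟩ := hz.compl.pow_bounds hw h2w hh
  set P := ((weight z : ℝ) / (2 * p.mid : ℕ)) ^ k with hP
  set P' := ((weight zᶜ : ℝ) / (2 * p.mid : ℕ)) ^ k with hP'
  have hL16 : (16 : ℝ) ≤ 2 ^ k := by
    calc (16 : ℝ) = 2 ^ 4 := by norm_num
      _ ≤ 2 ^ k := pow_le_pow_right₀ (by norm_num) hk
  set L : ℝ := 2 ^ k with hL
  have hLpos : 0 < L := by linarith
  have he : Real.exp 1 < 3 := Real.exp_one_lt_three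
  have hP0 : 0 ≤ P := by positivity
  have hP'0 : 0 ≤ P' := by positivity
  have hsum : P + P' ≤ 6 / L := by
    rw [le_div_iff₀ hLpos]
    nlinarith
  have h6L : 6 / L ≤ 1 / 2 := by
    rw [div_le_div_iff₀ hLpos (by norm_num)]
    linarith
  have hge := card_exists_label_ge (k := k) (L := 2 ^ k) (by omega) (by omega : 0 < 2 * p.mid)
    (by exact_mod_cast (by linarith : (2 : ℝ) ≤ 2 ^ k)) z (by linarith)
  refine le_trans ?_ hge
  rw [mul_comm]
  refine mul_le_mul_of_nonneg_left ?_ (Nat.cast_nonneg _)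
  rw [← hP, ← hP']
  push_cast
  rw [← hL]
  -- Here `P + P' ≤ 6/L` because `e < 3`, and `1 - x ≥ exp(-2x)`; at most `L` factors give the
  -- exponent `12`.
  have h1 : Real.exp (-12) ≤ (1 - P - P') ^ (2 ^ k - 2) := by
    have hb : Real.exp (-(2 * (6 / L))) ≤ 1 - P - P' := by
      have := exp_neg_two_mul_le_one_sub (by positivity) h6L
      linarith
    calc Real.exp (-12) ≤ Real.exp ((2 ^ k - 2 : ℕ) * (-(2 * (6 / L)))) := by
          rw [Real.exp_le_exp]
          have : ((2 ^ k - 2 : ℕ) : ℝ) ≤ L := by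
            rw [hL]
            exact_mod_cast Nat.sub_le _ _
          have h2 : ((2 ^ k - 2 : ℕ) : ℝ) * (6 / L) ≤ L * (6 / L) := by gcongr
          rw [mul_div_cancel₀ _ hLpos.ne'] at h2
          linarith
      _ = (Real.exp (-(2 * (6 / L)))) ^ (2 ^ k - 2) := by rw [← Real.exp_nat_mul]
      _ ≤ _ := by gcongr
  have h2 : 1 / 4 ≤ L * (L - 1) * (P * P') := by
    have : L * L / 2 ≤ L * (L - 1) := by nlinarith
    have hPP : 0 ≤ P * P' := by positivity
    nlinarith
  calc Real.exp (-12) / 4 = 1 / 4 * Real.exp (-12) := by ring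
    _ ≤ _ := by gcongr

theorem sum_card_labelled_ge (hk : 4 ≤ k) (hw : k * p.width ≤ p.mid)
    (h2w : 2 * p.width ≤ p.mid) (hh : 0 < p.mid) :
    Real.exp (-12) / 4 * Fintype.card (Fin (2 ^ k) → Fin k → Fin (2 * p.mid)) * (window p).card ≤
      ∑ T : Fin (2 ^ k) → Fin k → Fin (2 * p.mid), ((labelled p T).card : ℝ) := by
  classical
  have : ∑ T : Fin (2 ^ k) → Fin k → Fin (2 * p.mid), ((labelled p T).card : ℝ) =
      ∑ z ∈ window p, ((Finset.univ.filter fun T : Fin (2 ^ k) → Fin k → Fin (2 * p.mid) =>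
        ∃ i j, Label T z i j).card : ℝ) := by
    simp_rw [labelled, Finset.card_filter, Nat.cast_sum]
    rw [Finset.sum_comm]
  rw [this, mul_comm, ← nsmul_eq_mul, ← Finset.sum_const]
  exact Finset.sum_le_sum fun z hz =>
    card_exists_label_ge_of_inWindow hk hw h2w hh (mem_window.1 hz)

/-- Both weights are near `mid`, so the weight of the meet drops by half the Hamming distance. The
number `2^k` of terms compensates the density `1/2`, and the window radius costs at most a factor
`e`. -/
theorem card_common_sat_le (hw : k * p.width ≤ p.mid) (hh : 0 < p.mid)
    {z z' : Fin (2 * p.mid) → Bool} (hz : InWindow p.mid p.width z)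
    (hz' : InWindow p.mid p.width z') :
    ((Finset.univ.filter fun T : Fin (2 ^ k) → Fin k → Fin (2 * p.mid) =>
        ∃ i, Sat (T i) (z ⊓ z')).card : ℝ) ≤
      Fintype.card (Fin (2 ^ k) → Fin k → Fin (2 * p.mid)) *
        (Real.exp 1 * Real.exp (-(k / (2 * p.mid)) * hammingDist z z')) := by
  refine (card_exists_sat_le (by omega) _).trans (mul_le_mul_of_nonneg_left ?_ (Nat.cast_nonneg _))
  have hpos : 0 < (p.mid : ℝ) := by positivity
  have hkw : (k : ℝ) * p.width ≤ p.mid := by exact_mod_cast hw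
  have hinf : (2 : ℝ) * weight (z ⊓ z') + hammingDist z z' ≤ 2 * p.mid + 2 * p.width := by
    have h1 := two_mul_weight_inf_add z z'
    have h2 := hz.2
    have h3 := hz'.2
    exact_mod_cast (by omega : 2 * weight (z ⊓ z') + hammingDist z z' ≤ 2 * p.mid + 2 * p.width)
  set h : ℝ := (p.mid : ℝ) with hh'
  set d : ℝ := (hammingDist z z' : ℝ) with hd
  push_cast
  rw [← mul_pow]
  have h1 : 2 * ((weight (z ⊓ z') : ℝ) / (2 * h)) ≤ Real.exp (p.width / h - d / (2 * h)) := by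
    refine le_trans ?_ (Real.add_one_le_exp _)
    have : p.width / h - d / (2 * h) + 1 = (2 * h + 2 * p.width - d) / (2 * h) := by
      field_simp
      ring
    rw [this, mul_div_assoc']
    gcongr
    linarith
  calc (2 * ((weight (z ⊓ z') : ℝ) / (2 * h))) ^ k
      ≤ (Real.exp (p.width / h - d / (2 * h))) ^ k := by gcongr
    _ = Real.exp (k * (p.width / h - d / (2 * h))) := by rw [← Real.exp_nat_mul]
    _ ≤ _ := by
      rw [← Real.exp_add, Real.exp_le_exp]
      have : (k : ℝ) * (p.width / h) ≤ 1 := by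
        rw [mul_div_assoc', div_le_one hpos]
        exact hkw
      have h2 : (k : ℝ) * (d / (2 * h)) = k / (2 * h) * d := by ring
      rw [mul_sub, h2]
      linarith

/-- If `z` and `z'` have the same unordered label, then `z` shares a satisfied term with `z'` or
with `z'ᶜ`. Complementation preserves the window, hence the factor `2`; the sum over `z'` then
extends to the whole cube, where it factorises. -/
theorem sum_card_sharing_le (hw : k * p.width ≤ p.mid) (hh : 0 < p.mid) :
    ∑ T : Fin (2 ^ k) → Fin k → Fin (2 * p.mid), ((sharing p T).card : ℝ) ≤
      Fintype.card (Fin (2 ^ k) → Fin k → Fin (2 * p.mid)) *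
        (2 * Real.exp 1 * (window p).card * (1 + Real.exp (-(k / (2 * p.mid)))) ^ (2 * p.mid)) := by
  classical
  set N := Fintype.card (Fin (2 ^ k) → Fin k → Fin (2 * p.mid)) with hN
  set c : (Fin (2 * p.mid) → Bool) → (Fin (2 * p.mid) → Bool) → ℝ := fun z z' =>
    ((Finset.univ.filter fun T : Fin (2 ^ k) → Fin k → Fin (2 * p.mid) =>
        ∃ i, Sat (T i) (z ⊓ z')).card : ℝ) with hc
  have h1 : ∀ T : Fin (2 ^ k) → Fin k → Fin (2 * p.mid), ((sharing p T).card : ℝ) ≤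
      ∑ z ∈ window p, ∑ z' ∈ window p, ((if ∃ i, Sat (T i) (z ⊓ z') then 1 else 0) +
        if ∃ i, Sat (T i) (z ⊓ z'ᶜ) then 1 else 0) := by
    intro T
    rw [sharing, Finset.card_filter, Nat.cast_sum, Finset.sum_product]
    refine Finset.sum_le_sum fun z _ => Finset.sum_le_sum fun z' _ => ?_
    by_cases h : ∃ i j i' j', Label T z i j ∧ Label T z' i' j' ∧ pairIndex i j = pairIndex i' j'
    · rw [if_pos h]
      obtain ⟨i, j, i', j', hl, hl', he⟩ := h
      rcases pairIndex_eq_iff.1 he with ⟨rfl, rfl⟩ | ⟨rfl, rfl⟩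
      · rw [if_pos ⟨i, sat_inf.2 ⟨(hl.1 _).2 rfl, (hl'.1 _).2 rfl⟩⟩]
        split_ifs <;> norm_num
      · rw [if_pos (c := ∃ l, Sat (T l) (z ⊓ z'ᶜ))
          ⟨i, sat_inf.2 ⟨(hl.1 _).2 rfl, (hl'.2 _).2 rfl⟩⟩]
        split_ifs <;> norm_num
    · rw [if_neg h]
      split_ifs <;> norm_num
  have h2 : ∑ T : Fin (2 ^ k) → Fin k → Fin (2 * p.mid), ((sharing p T).card : ℝ) ≤
      ∑ z ∈ window p, ∑ z' ∈ window p, (c z z' + c z z'ᶜ) := by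
    refine (Finset.sum_le_sum fun T _ => h1 T).trans (le_of_eq ?_)
    rw [Finset.sum_comm]
    refine Finset.sum_congr rfl fun z _ => ?_
    rw [Finset.sum_comm]
    refine Finset.sum_congr rfl fun z' _ => ?_
    rw [Finset.sum_add_distrib, Finset.sum_boole, Finset.sum_boole]
  have h3 : ∀ z ∈ window p, ∑ z' ∈ window p, (c z z' + c z z'ᶜ) =
      2 * ∑ z' ∈ window p, c z z' := by
    intro z _
    have hmem : ∀ z' ∈ window p, z'ᶜ ∈ window p := fun z' hz' =>
      mem_window.2 (mem_window.1 hz').compl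
    have : ∑ z' ∈ window p, c z z'ᶜ = ∑ z' ∈ window p, c z z' :=
      Finset.sum_bij' (fun z _ => zᶜ) (fun z _ => zᶜ) hmem hmem (by simp) (by simp) (by simp)
    rw [Finset.sum_add_distrib, this]
    ring
  have h4 : ∀ z ∈ window p, ∑ z' ∈ window p, c z z' ≤
      N * (Real.exp 1 * (1 + Real.exp (-(k / (2 * p.mid)))) ^ (2 * p.mid)) := by
    intro z hz
    calc ∑ z' ∈ window p, c z z'
        ≤ ∑ z' ∈ window p, N * (Real.exp 1 *
            Real.exp (-(k / (2 * p.mid)) * hammingDist z z')) :=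
          Finset.sum_le_sum fun z' hz' =>
            card_common_sat_le hw hh (mem_window.1 hz) (mem_window.1 hz')
      _ ≤ ∑ z', N * (Real.exp 1 * Real.exp (-(k / (2 * p.mid)) * hammingDist z z')) :=
          Finset.sum_le_sum_of_subset_of_nonneg (Finset.subset_univ _) fun _ _ _ => by positivity
      _ = _ := by
          rw [← Finset.mul_sum, ← Finset.mul_sum, sum_exp_neg_hammingDist]
  refine h2.trans ?_
  rw [Finset.sum_congr rfl h3, ← Finset.mul_sum]
  refine (mul_le_mul_of_nonneg_left (Finset.sum_le_sum h4) (by norm_num)).trans (le_of_eq ?_)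
  rw [Finset.sum_const, nsmul_eq_mul]
  ring

end RandomTerms

/-! ### Binomial estimates: size of the window and number of low points. -/

section Binomial

theorem centralBinom_sq_mul_le (b : ℕ) : b.centralBinom ^ 2 * (2 * b + 1) ≤ 16 ^ b := by
  induction b with
  | zero => simp
  | succ b ih =>
    have h := Nat.succ_mul_centralBinom_succ b
    refine Nat.le_of_mul_le_mul_left ?_ (show 0 < (b + 1) ^ 2 by positivity)
    calc (b + 1) ^ 2 * ((b + 1).centralBinom ^ 2 * (2 * (b + 1) + 1))
        = ((b + 1) * (b + 1).centralBinom) ^ 2 * (2 * (b + 1) + 1) := by ring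
      _ = (b.centralBinom ^ 2 * (2 * b + 1)) * (4 * ((2 * b + 1) * (2 * b + 3))) := by
          rw [h]; ring
      _ ≤ 16 ^ b * (4 * (4 * (b + 1) ^ 2)) := by
          refine Nat.mul_le_mul ih ?_
          nlinarith
      _ = (b + 1) ^ 2 * 16 ^ (b + 1) := by ring

theorem le_centralBinom_sq_mul {b : ℕ} (hb : 0 < b) : 16 ^ b ≤ b.centralBinom ^ 2 * (4 * b) := by
  induction b, hb using Nat.le_induction with
  | base => simp [Nat.centralBinom, Nat.choose]
  | succ b hb ih =>
    have h := Nat.succ_mul_centralBinom_succ b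
    refine Nat.le_of_mul_le_mul_left ?_ (show 0 < (b + 1) ^ 2 by positivity)
    calc (b + 1) ^ 2 * 16 ^ (b + 1) = 16 ^ b * (16 * (b + 1) ^ 2) := by ring
      _ ≤ (b.centralBinom ^ 2 * (4 * b)) * (16 * (b + 1) ^ 2) := Nat.mul_le_mul_right _ ih
      _ = (b.centralBinom ^ 2 * (16 * (b + 1))) * (4 * (b * (b + 1))) := by ring
      _ ≤ (b.centralBinom ^ 2 * (16 * (b + 1))) * (2 * b + 1) ^ 2 := by
          refine Nat.mul_le_mul_left _ ?_
          nlinarith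
      _ = (2 * (2 * b + 1) * b.centralBinom) ^ 2 * (4 * (b + 1)) := by ring
      _ = (b + 1) ^ 2 * ((b + 1).centralBinom ^ 2 * (4 * (b + 1))) := by
          rw [← h]; ring

theorem choose_half_sq_mul_le (a : ℕ) : a.choose (a / 2) ^ 2 * a ≤ 4 ^ a := by
  rcases Nat.even_or_odd' a with ⟨b, rfl | rfl⟩
  · have h := centralBinom_sq_mul_le b
    rw [Nat.centralBinom] at h
    rw [Nat.mul_div_cancel_left _ (by norm_num), pow_mul]
    norm_num
    nlinarith [sq_nonneg ((2 * b).choose b)]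
  · have h := centralBinom_sq_mul_le (b + 1)
    have h2 : (b + 1).centralBinom = 2 * (2 * b + 1).choose b := by
      rw [Nat.centralBinom_eq_two_mul_choose, show 2 * (b + 1) = 2 * b + 1 + 1 by ring,
        Nat.choose_succ_succ', ← Nat.choose_symm_half b]
      ring
    rw [h2] at h
    rw [show (2 * b + 1) / 2 = b by omega]
    have h3 : 4 ^ (2 * b + 1) * 4 = 16 ^ (b + 1) := by
      rw [← pow_succ, show 2 * b + 1 + 1 = 2 * (b + 1) by ring, pow_mul]
      norm_num
    nlinarith [sq_nonneg ((2 * b + 1).choose b)]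

/-- Induction on `s` with the ratio `(h - s) / (h + s + 1)` of neighbouring coefficients. Layers at
distance `s` with `2s² ≤ h` therefore keep at least half the central size. -/
theorem choose_mul_sub_sq_le {h s : ℕ} (hs : s ≤ h) :
    ((2 * h).choose h : ℝ) * (h - s ^ 2) ≤ (2 * h).choose (h + s) * h := by
  induction s with
  | zero => simp
  | succ s ih =>
    have ih := ih (by omega)
    have h1 := Nat.choose_succ_right_eq (2 * h) (h + s)
    rw [show 2 * h - (h + s) = h - s by omega] at h1
    have h2 : ((2 * h).choose (h + (s + 1)) : ℝ) * (h + s + 1) =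
        (2 * h).choose (h + s) * (h - s) := by
      have := congrArg (Nat.cast (R := ℝ)) h1
      push_cast [Nat.cast_sub (show s ≤ h by omega)] at this
      exact this
    have hsh : (s : ℝ) + 1 ≤ h := by exact_mod_cast hs
    have hs0 : (0 : ℝ) ≤ s := Nat.cast_nonneg _
    have hc : (0 : ℝ) ≤ (2 * h).choose h := Nat.cast_nonneg _
    have hpos : (0 : ℝ) < h + s + 1 := by linarith
    refine le_of_mul_le_mul_right ?_ hpos
    calc ((2 * h).choose h : ℝ) * (h - ((s + 1 : ℕ) : ℝ) ^ 2) * (h + s + 1)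
        ≤ ((2 * h).choose h : ℝ) * ((h - s ^ 2) * (h - s)) := by
          rw [mul_assoc]
          refine mul_le_mul_of_nonneg_left ?_ hc
          push_cast
          have : 0 ≤ (s : ℝ) ^ 3 + (s + 1) ^ 3 := by positivity
          nlinarith
      _ ≤ ((2 * h).choose (h + s) : ℝ) * h * (h - s) := by
          rw [← mul_assoc]
          exact mul_le_mul_of_nonneg_right ih (by linarith)
      _ = ((2 * h).choose (h + (s + 1)) : ℝ) * h * (h + s + 1) := by
          rw [mul_right_comm _ (h : ℝ) ((h : ℝ) - s), ← h2]
          ring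

theorem card_window_ge {p : HardParams} (hh : 0 < p.mid) (hw : 2 * p.width ^ 2 ≤ p.mid) :
    (p.width + 1) * 2 ^ (2 * p.mid) / (4 * Real.sqrt p.mid) ≤ (window p).card := by
  classical
  set h := p.mid with hhdef
  have hpos : (0 : ℝ) < h := by exact_mod_cast hh
  have hsub : (Finset.range (p.width + 1)).biUnion (fun s => Finset.univ.filter
      fun z : Fin (2 * h) → Bool => weight z = h + s) ⊆ window p := by
    intro z hz
    simp only [Finset.mem_biUnion, Finset.mem_range, Finset.mem_filter, Finset.mem_univ,
      true_and] at hz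
    obtain ⟨s, hs, hz⟩ := hz
    rw [mem_window]
    unfold InWindow
    omega
  have h1 := Finset.card_le_card hsub
  rw [Finset.card_biUnion] at h1
  · have hcb : (2 : ℝ) ^ (2 * h) ≤ (2 * h).choose h * (2 * Real.sqrt h) := by
      have := le_centralBinom_sq_mul hh
      rw [Nat.centralBinom] at this
      have h2 : (16 : ℝ) ^ h ≤ ((2 * h).choose h : ℝ) ^ 2 * (4 * h) := by exact_mod_cast this
      refine le_of_sq_le_sq ?_ (by positivity)
      rw [mul_pow, mul_pow, Real.sq_sqrt hpos.le, ← pow_mul, mul_comm (2 * h) 2, pow_mul, pow_mul]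
      norm_num
      linarith
    have h3 : ∀ s ∈ Finset.range (p.width + 1), (2 : ℝ) ^ (2 * h) / (4 * Real.sqrt h) ≤
        ((Finset.univ.filter fun z : Fin (2 * h) → Bool => weight z = h + s).card : ℝ) := by
      intro s hs
      rw [Finset.mem_range] at hs
      rw [card_weight_eq, Fintype.card_fin]
      have hsw : s ^ 2 ≤ p.width ^ 2 := Nat.pow_le_pow_left (by omega) 2
      have hs2 : 2 * s ^ 2 ≤ h := by omega
      have hsh : s ≤ h := by nlinarith
      have h4 := choose_mul_sub_sq_le hsh
      have hs2' : 2 * (s : ℝ) ^ 2 ≤ h := by exact_mod_cast hs2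
      have hc : (0 : ℝ) ≤ (2 * h).choose h := Nat.cast_nonneg _
      have h5 : ((2 * h).choose h : ℝ) / 2 ≤ (2 * h).choose (h + s) := by
        refine le_of_mul_le_mul_right ?_ hpos
        nlinarith
      refine le_trans ?_ h5
      have hsq : 0 < Real.sqrt h := Real.sqrt_pos.2 hpos
      rw [div_le_div_iff₀ (by positivity) (by norm_num)]
      nlinarith
    have h6 := Finset.sum_le_sum h3
    rw [Finset.sum_const, Finset.card_range, nsmul_eq_mul] at h6
    push_cast at h6
    rw [mul_div_assoc]
    refine h6.trans ?_
    exact_mod_cast h1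
  · intro s _ s' _ hne
    rw [Function.onFun, Finset.disjoint_filter]
    intro z _ h1 h2
    omega

/-- At most `t` layers are neither low nor high. Each has size at most `2^a / √a`, so together they
cover at most half of the cube; complementation splits the rest evenly. -/
theorem lowCount_ge {a t : ℕ} (hta : 4 * t ^ 2 ≤ a) :
    2 ^ a ≤ 4 * lowCount a t := by
  classical
  set high := (Finset.univ.filter fun u : Fin a → Bool => High t u).card with hhigh
  have hsym : high = lowCount a t := by
    refine Finset.card_bij' (fun u _ => uᶜ) (fun u _ => uᶜ) ?_ ?_ (by simp) (by simp)
    · intro u hu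
      simp only [Finset.mem_filter, Finset.mem_univ, true_and] at hu ⊢
      exact low_compl_iff.2 hu
    · intro u hu
      simp only [Finset.mem_filter, Finset.mem_univ, true_and] at hu ⊢
      exact high_compl_iff.2 hu
  set I := (Finset.range (a + 1)).filter fun v => a < 2 * v + t ∧ 2 * v < a + t with hI
  have hIcard : I.card ≤ t := by
    have : I ⊆ Finset.Ico ((a + 2 - t) / 2) ((a + 2 - t) / 2 + t) := by
      intro v hv
      simp only [hI, Finset.mem_filter, Finset.mem_range] at hv
      rw [Finset.mem_Ico]
      omega
    have := Finset.card_le_card this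
    simpa using this
  have hcover : (Finset.univ : Finset (Fin a → Bool)) ⊆
      (Finset.univ.filter fun u : Fin a → Bool => Low t u) ∪
      (Finset.univ.filter fun u : Fin a → Bool => High t u) ∪
      I.biUnion fun v => Finset.univ.filter fun u : Fin a → Bool => weight u = v := by
    intro u _
    have := weight_add_weight_compl u
    rw [Fintype.card_fin] at this
    simp only [Finset.mem_union, Finset.mem_filter, Finset.mem_univ, true_and, hI,
      Finset.mem_biUnion, Finset.mem_range]
    by_cases h1 : 2 * weight u + t ≤ a
    · exact Or.inl (Or.inl h1)
    · by_cases h2 : a + t ≤ 2 * weight u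
      · exact Or.inl (Or.inr h2)
      · exact Or.inr ⟨weight u, by omega, rfl⟩
  have h1 := (Finset.card_le_card hcover).trans ((Finset.card_union_le _ _).trans
    (Nat.add_le_add (Finset.card_union_le _ _) Finset.card_biUnion_le))
  have h2 : ∑ v ∈ I, (Finset.univ.filter fun u : Fin a → Bool => weight u = v).card ≤
      t * a.choose (a / 2) := by
    calc _ ≤ ∑ v ∈ I, a.choose (a / 2) := by
          refine Finset.sum_le_sum fun v _ => ?_
          rw [card_weight_eq, Fintype.card_fin]
          exact Nat.choose_le_middle v a
      _ = I.card * a.choose (a / 2) := by rw [Finset.sum_const, smul_eq_mul]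
      _ ≤ _ := Nat.mul_le_mul_right _ hIcard
  have h3 : 2 * (t * a.choose (a / 2)) ≤ 2 ^ a := by
    refine (Nat.pow_le_pow_iff_left two_ne_zero).1 ?_
    have h4 := choose_half_sq_mul_le a
    calc (2 * (t * a.choose (a / 2))) ^ 2 = 4 * t ^ 2 * a.choose (a / 2) ^ 2 := by ring
      _ ≤ a * a.choose (a / 2) ^ 2 := Nat.mul_le_mul_right _ hta
      _ ≤ 4 ^ a := by rw [mul_comm]; exact h4
      _ = (2 ^ a) ^ 2 := by rw [← pow_mul, mul_comm, pow_mul]; norm_num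
  have h5 : (Finset.univ : Finset (Fin a → Bool)).card = 2 ^ a := by simp
  rw [h5, ← hhigh, hsym, ← lowCount] at h1
  omega

end Binomial

/-! ### Random splittings of the coordinates. -/

section Embeddings

theorem exists_sum_equiv_extending {a m n : ℕ} (hn : n = a + m) (f : Fin a → Fin n)
    (hf : Function.Injective f) : ∃ e : Fin a ⊕ Fin m ≃ Fin n, ∀ i, e (Sum.inl i) = f i := by
  classical
  have hcard : Fintype.card (Fin m) = Fintype.card ↥(Set.range f)ᶜ := by
    rw [Fintype.card_compl_set, Set.card_range_of_injective hf]
    simp [hn]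
  refine ⟨((Equiv.ofInjective f hf).sumCongr (Fintype.equivOfCardEq hcard)).trans
    (Equiv.Set.sumCompl (Set.range f)), fun i => ?_⟩
  simp

/-- A family of splittings of the coordinates in which the action coordinates are picked
independently from `a` disjoint blocks of size `l`. -/
theorem exists_splittings {a m n l : ℕ} (hn : n = a + m) (hl : 0 < l) (hal : a * l ≤ n) :
    ∃ e : (Fin a → Fin l) → (Fin a ⊕ Fin m ≃ Fin n), ∀ (D : Finset (Fin n)) (y : ℝ), 0 ≤ y →
      ∑ r, Real.exp (y * (Finset.univ.filter fun i => e r (Sum.inl i) ∈ D).card) ≤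
        Fintype.card (Fin a → Fin l) * Real.exp ((Real.exp y - 1) * D.card / l) := by
  classical
  set φ : Fin a × Fin l → Fin n := fun q => Fin.castLE hal (finProdFinEquiv q) with hφ
  have hφinj : Function.Injective φ := (Fin.castLE_injective hal).comp finProdFinEquiv.injective
  choose e he using fun r : Fin a → Fin l => exists_sum_equiv_extending hn (fun i => φ (i, r i))
    (fun i j h => (Prod.mk.inj (hφinj h)).1)
  refine ⟨e, fun D y hy => ?_⟩
  have hlR : (0 : ℝ) < l := by exact_mod_cast hl
  have hexp : 0 ≤ Real.exp y - 1 := by linarith [Real.add_one_le_exp y]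
  set d : Fin a → ℕ := fun i => (Finset.univ.filter fun j => φ (i, j) ∈ D).card with hd
  have hdsum : ∑ i, d i ≤ D.card := by
    rw [← Finset.card_sigma]
    refine Finset.card_le_card_of_injOn (fun q => φ (q.1, q.2)) ?_ ?_
    · rintro ⟨i, j⟩ h
      simpa using h
    · rintro ⟨i, j⟩ - ⟨i', j'⟩ - h
      obtain ⟨rfl, rfl⟩ := Prod.mk.inj (hφinj h)
      rfl
  have h1 : ∀ r : Fin a → Fin l,
      Real.exp (y * (Finset.univ.filter fun i => e r (Sum.inl i) ∈ D).card) =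
        ∏ i, if φ (i, r i) ∈ D then Real.exp y else 1 := by
    intro r
    simp_rw [he]
    rw [Finset.card_filter, Nat.cast_sum, Finset.mul_sum, Real.exp_sum]
    refine Finset.prod_congr rfl fun i _ => ?_
    split_ifs <;> simp
  have h2 := Finset.prod_univ_sum (fun _ : Fin a => (Finset.univ : Finset (Fin l)))
    (fun i j => if φ (i, j) ∈ D then Real.exp y else 1)
  rw [Fintype.piFinset_univ] at h2
  simp_rw [h1]
  rw [← h2]
  -- The average over block `i` is `1 + (e^y - 1) d i / l`, bounded by an exponential so that the
  -- product over blocks depends only on `∑ d i ≤ |D|`.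
  have h3 : ∀ i : Fin a, ∑ j, (if φ (i, j) ∈ D then Real.exp y else 1) ≤
      l * Real.exp ((Real.exp y - 1) * d i / l) := by
    intro i
    have : ∀ j, (if φ (i, j) ∈ D then Real.exp y else 1) =
        1 + (Real.exp y - 1) * if φ (i, j) ∈ D then 1 else 0 := by
      intro j
      split_ifs <;> ring
    simp_rw [this]
    rw [Finset.sum_add_distrib, ← Finset.mul_sum, Finset.sum_boole]
    have h4 := Real.add_one_le_exp ((Real.exp y - 1) * d i / l)
    have h5 : (l : ℝ) * ((Real.exp y - 1) * d i / l + 1) = l + (Real.exp y - 1) * d i := by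
      field_simp
      ring
    have h6 := mul_le_mul_of_nonneg_left h4 hlR.le
    rw [h5] at h6
    simpa using h6
  calc ∏ i, ∑ j, (if φ (i, j) ∈ D then Real.exp y else 1)
      ≤ ∏ i : Fin a, (l * Real.exp ((Real.exp y - 1) * d i / l)) :=
        Finset.prod_le_prod (fun i _ => Finset.sum_nonneg fun j _ => by positivity) fun i _ => h3 i
    _ = l ^ a * Real.exp (∑ i, (Real.exp y - 1) * d i / l) := by
        rw [Finset.prod_mul_distrib, Real.exp_sum]
        simp
    _ ≤ _ := by
        rw [← Finset.sum_div, ← Finset.mul_sum]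
        simp only [Fintype.card_pi_const, Fintype.card_fin, Nat.cast_pow]
        gcongr
        exact_mod_cast hdsum

end Embeddings

/-! ### The lower bound for general parameters. -/

section Combine
variable {k : ℕ} {p : HardParams}

/-- A lower bound for the probability that a point in the weight window has a label. -/
noncomputable def labelProb : ℝ := Real.exp (-12) / 4

theorem labelProb_pos : 0 < labelProb := by unfold labelProb; positivity

theorem card_labelled_le (T : Fin (2 ^ k) → Fin k → Fin (2 * p.mid)) :
    (labelled p T).card ≤ (window p).card := Finset.card_filter_le _ _

/-- Many families of terms label a large part of the window, in a balanced way. -/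
theorem exists_good_terms (hk : 4 ≤ k) (hw : k * p.width ≤ p.mid) (h2w : 2 * p.width ≤ p.mid)
    (hh : 0 < p.mid) {η : ℝ} (hη : 0 < η)
    (hQ : 2 * Real.exp 1 * (1 + Real.exp (-(k / (2 * p.mid)))) ^ (2 * p.mid) ≤
      labelProb / 4 * (η * (window p).card)) :
    ∃ G : Finset (Fin (2 ^ k) → Fin k → Fin (2 * p.mid)),
      labelProb / 4 * Fintype.card (Fin (2 ^ k) → Fin k → Fin (2 * p.mid)) ≤ G.card ∧
      ∀ T ∈ G, labelProb * (window p).card ≤ 2 * (labelled p T).card ∧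
        ((sharing p T).card : ℝ) ≤ η * (window p).card ^ 2 := by
  classical
  have hc := labelProb_pos
  set W : ℝ := ((window p).card : ℝ) with hW
  set N : ℝ := (Fintype.card (Fin (2 ^ k) → Fin k → Fin (2 * p.mid)) : ℝ) with hN
  have hW0 : 0 < W := by
    by_contra hcon
    have : W = 0 := le_antisymm (not_lt.1 hcon) (Nat.cast_nonneg _)
    rw [this, mul_zero, mul_zero] at hQ
    have : 0 < 2 * Real.exp 1 * (1 + Real.exp (-(k / (2 * p.mid : ℝ)))) ^ (2 * p.mid) := by
      positivity
    linarith
  have hN0 : 0 ≤ N := Nat.cast_nonneg _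
  set A := Finset.univ.filter fun T : Fin (2 ^ k) → Fin k → Fin (2 * p.mid) =>
    labelProb * W ≤ 2 * (labelled p T).card with hA
  set B := Finset.univ.filter fun T : Fin (2 ^ k) → Fin k → Fin (2 * p.mid) =>
    η * W ^ 2 < (sharing p T).card with hB
  -- Reverse Markov inequality: the labelled part has average at least `labelProb * W` and never
  -- exceeds `W`.
  have hAcard : labelProb / 2 * N ≤ A.card := by
    have h1 : ∑ T : Fin (2 ^ k) → Fin k → Fin (2 * p.mid), ((labelled p T).card : ℝ) ≤
        ∑ T : Fin (2 ^ k) → Fin k → Fin (2 * p.mid),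
          ((if T ∈ A then W else 0) + labelProb * W / 2) := by
      refine Finset.sum_le_sum fun T _ => ?_
      by_cases hT : T ∈ A
      · rw [if_pos hT]
        have : ((labelled p T).card : ℝ) ≤ W := Nat.cast_le.2 (card_labelled_le T)
        have : 0 ≤ labelProb * W / 2 := by positivity
        linarith
      · rw [if_neg hT]
        simp only [hA, Finset.mem_filter, Finset.mem_univ, true_and, not_le] at hT
        linarith
    have h2 := (sum_card_labelled_ge hk hw h2w hh).trans h1
    rw [Finset.sum_add_distrib, Finset.sum_ite_mem, Finset.univ_inter, Finset.sum_const,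
      Finset.sum_const, Finset.card_univ, nsmul_eq_mul, nsmul_eq_mul, ← hN, ← hW] at h2
    refine le_of_mul_le_mul_right ?_ hW0
    unfold labelProb at *
    linarith
  -- Markov's inequality for the number of sharing pairs.
  have hBcard : (B.card : ℝ) ≤ labelProb / 4 * N := by
    have h1 : ∑ T ∈ B, η * W ^ 2 ≤ N * (2 * Real.exp 1 * W *
        (1 + Real.exp (-(k / (2 * p.mid)))) ^ (2 * p.mid)) :=
      calc ∑ T ∈ B, η * W ^ 2 ≤ ∑ T ∈ B, ((sharing p T).card : ℝ) :=
            Finset.sum_le_sum fun T hT => (Finset.mem_filter.1 hT).2.le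
        _ ≤ ∑ T : Fin (2 ^ k) → Fin k → Fin (2 * p.mid), ((sharing p T).card : ℝ) :=
            Finset.sum_le_sum_of_subset_of_nonneg (Finset.subset_univ _)
              fun _ _ _ => Nat.cast_nonneg _
        _ ≤ _ := sum_card_sharing_le hw hh
    rw [Finset.sum_const, nsmul_eq_mul] at h1
    refine le_of_mul_le_mul_right ?_ (by positivity : 0 < η * W ^ 2)
    refine h1.trans ?_
    calc _ = N * W * (2 * Real.exp 1 *
          (1 + Real.exp (-(k / (2 * p.mid : ℝ)))) ^ (2 * p.mid)) := by ring
      _ ≤ N * W * (labelProb / 4 * (η * W)) := by gcongr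
      _ = _ := by ring
  refine ⟨A \ B, ?_, fun T hT => ?_⟩
  · have h1 : (A.card : ℝ) ≤ (A \ B).card + B.card := by
      exact_mod_cast Finset.card_le_card_sdiff_add_card
    linarith
  · rw [Finset.mem_sdiff] at hT
    refine ⟨(Finset.mem_filter.1 hT.1).2, ?_⟩
    have := hT.2
    simp only [hB, Finset.mem_filter, Finset.mem_univ, true_and, not_lt] at this
    exact this

theorem hammingDist_split {n a m : ℕ} (e : Fin a ⊕ Fin m ≃ Fin n) (x y : Cube n) :
    hammingDist x y = hammingDist (cubeSplit e x).1 (cubeSplit e y).1 +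
      hammingDist (cubeSplit e x).2 (cubeSplit e y).2 := by
  simp only [hammingDist_eq_sum]
  rw [← e.sum_comp, Fintype.sum_sum_type]
  rfl

-- A Chernoff bound. For fixed `r`, the terms contribute `e · exp(-lam · d_C)` with `d_C` the
-- control distance, and the event that the action distance `d_A` is at least the gap is bounded by
-- `exp(θ (d_A - gap))`. Since `d_C = |D| - d_A`, it remains to average `exp((θ + lam) d_A)` over
-- the splittings, and the last hypothesis on `θ` lets `exp(-lam |D|)` absorb this average.
open Classical in
theorem card_collide_le {n a l : ℕ} (hw : k * p.width ≤ p.mid) (hh : 0 < p.mid) (hl : 0 < l)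
    {e : (Fin a → Fin l) → (Fin a ⊕ Fin (2 * p.mid) ≃ Fin n)}
    (he : ∀ (D : Finset (Fin n)) (y : ℝ), 0 ≤ y →
      ∑ r, Real.exp (y * (Finset.univ.filter fun i => e r (Sum.inl i) ∈ D).card) ≤
        Fintype.card (Fin a → Fin l) * Real.exp ((Real.exp y - 1) * D.card / l))
    {θ : ℝ} (hθ : 0 ≤ θ) (hθ1 : θ + k / (2 * p.mid) ≤ 1)
    (hθl : 2 * (θ + k / (2 * p.mid)) ≤ k / (2 * p.mid) * l) (x y : Cube n) :
    ((Finset.univ.filter fun ω : (Fin (2 ^ k) → Fin k → Fin (2 * p.mid)) × (Fin a → Fin l) =>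
        Collide p (e ω.2) ω.1 x y).card : ℝ) ≤
      Fintype.card (Fin (2 ^ k) → Fin k → Fin (2 * p.mid)) * Fintype.card (Fin a → Fin l) *
        Real.exp (1 - θ * p.gap) := by
  set N : ℝ := (Fintype.card (Fin (2 ^ k) → Fin k → Fin (2 * p.mid)) : ℝ) with hN
  set lam : ℝ := k / (2 * p.mid) with hlam
  have hlam0 : 0 ≤ lam := by positivity
  have hlR : (0 : ℝ) < l := by exact_mod_cast hl
  set D := Finset.univ.filter fun i => x i ≠ y i with hD
  have hDx : D.card = hammingDist x y := rfl
  have hper : ∀ r : Fin a → Fin l,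
      ((Finset.univ.filter fun T : Fin (2 ^ k) → Fin k → Fin (2 * p.mid) =>
        Collide p (e r) T x y).card : ℝ) ≤
      N * Real.exp (1 - θ * p.gap) * (Real.exp (-lam * D.card) *
        Real.exp ((θ + lam) * (Finset.univ.filter fun i => e r (Sum.inl i) ∈ D).card)) := by
    intro r
    have hdA : (Finset.univ.filter fun i => e r (Sum.inl i) ∈ D).card =
        hammingDist (cubeSplit (e r) x).1 (cubeSplit (e r) y).1 := by
      simp only [hD, Finset.mem_filter, Finset.mem_univ, true_and]
      rfl
    by_cases hcol : InWindow p.mid p.width (cubeSplit (e r) x).2 ∧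
        InWindow p.mid p.width (cubeSplit (e r) y).2 ∧
        p.gap ≤ hammingDist (cubeSplit (e r) x).1 (cubeSplit (e r) y).1
    · have h1 : (Finset.univ.filter fun T : Fin (2 ^ k) → Fin k → Fin (2 * p.mid) =>
          Collide p (e r) T x y).card ≤
          (Finset.univ.filter fun T : Fin (2 ^ k) → Fin k → Fin (2 * p.mid) =>
            ∃ i, Sat (T i) ((cubeSplit (e r) x).2 ⊓ (cubeSplit (e r) y).2)).card := by
        refine Finset.card_le_card fun T hT => ?_
        rw [Finset.mem_filter] at hT ⊢
        exact ⟨hT.1, hT.2.2.2.1⟩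
      have h2 := card_common_sat_le hw hh hcol.1 hcol.2.1
      refine (Nat.cast_le.2 h1).trans (le_trans (le_of_eq ?_) (h2.trans ?_))
      · congr!
      rw [mul_assoc, ← Real.exp_add, ← Real.exp_add, ← Real.exp_add, hdA, hDx,
        hammingDist_split (e r)]
      refine mul_le_mul_of_nonneg_left (Real.exp_le_exp.2 ?_) (Nat.cast_nonneg _)
      have h3 : (p.gap : ℝ) ≤ hammingDist (cubeSplit (e r) x).1 (cubeSplit (e r) y).1 := by
        exact_mod_cast hcol.2.2
      have h4 := mul_le_mul_of_nonneg_left h3 hθ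
      push_cast
      rw [← hlam]
      nlinarith
    · rw [Finset.filter_eq_empty_iff.2, Finset.card_empty, Nat.cast_zero]
      · positivity
      · intro T _ hT
        exact hcol ⟨hT.1, hT.2.1, hT.2.2.2⟩
  have hcard : ((Finset.univ.filter
      fun ω : (Fin (2 ^ k) → Fin k → Fin (2 * p.mid)) × (Fin a → Fin l) =>
        Collide p (e ω.2) ω.1 x y).card : ℝ) =
      ∑ r : Fin a → Fin l, ((Finset.univ.filter fun T : Fin (2 ^ k) → Fin k → Fin (2 * p.mid) =>
        Collide p (e r) T x y).card : ℝ) := by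
    simp_rw [Finset.card_filter, Nat.cast_sum]
    rw [Fintype.sum_prod_type_right]
  rw [hcard]
  refine (Finset.sum_le_sum fun r _ => hper r).trans ?_
  rw [← Finset.mul_sum, ← Finset.mul_sum]
  have hy0 : 0 ≤ θ + lam := by positivity
  have h5 := he D (θ + lam) hy0
  -- Uses `e^y - 1 ≤ 2y` for `0 ≤ y ≤ 1`.
  have h6 : Real.exp (θ + lam) - 1 ≤ lam * l := by
    have := Real.abs_exp_sub_one_le (x := θ + lam) (by rw [abs_of_nonneg hy0]; exact hθ1)
    rw [abs_of_nonneg hy0] at this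
    exact (le_abs_self _).trans (this.trans hθl)
  have h7 : Real.exp (-lam * D.card) *
      ∑ r, Real.exp ((θ + lam) * (Finset.univ.filter fun i => e r (Sum.inl i) ∈ D).card) ≤
      Fintype.card (Fin a → Fin l) := by
    calc _ ≤ Real.exp (-lam * D.card) * (Fintype.card (Fin a → Fin l) *
          Real.exp ((Real.exp (θ + lam) - 1) * D.card / l)) := by gcongr
      _ ≤ Real.exp (-lam * D.card) * (Fintype.card (Fin a → Fin l) *
          Real.exp (lam * D.card)) := by
          gcongr
          rw [div_le_iff₀ hlR]
          calc _ ≤ lam * l * D.card := by gcongr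
            _ = _ := by ring
      _ = _ := by
          rw [mul_left_comm, ← Real.exp_add]
          simp
  calc _ ≤ N * Real.exp (1 - θ * p.gap) * Fintype.card (Fin a → Fin l) := by gcongr
    _ = _ := by ring

/-- The factor `64` collects `2` from labelled versus window, `4` from active versus labelled, `4`
from low points versus the action cube, and `2` from the double count. -/
theorem isFar_hardFun {n a : ℕ} (hn : n = a + 2 * p.mid) (hgap : 4 * p.gap ^ 2 ≤ a)
    (e : Fin a ⊕ Fin (2 * p.mid) ≃ Fin n) {T : Fin (2 ^ k) → Fin k → Fin (2 * p.mid)}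
    {β : Fin (2 ^ k) × Fin (2 ^ k) → Bool}
    (hT : labelProb * (window p).card ≤ 2 * (labelled p T).card)
    (hβ : (labelled p T).card ≤ 4 * (activeControls p T β).card) {ε : ℝ}
    (hε : ε * (64 * 2 ^ (2 * p.mid)) ≤ labelProb * (window p).card) :
    IsFar ε (hardFun p e T (noFlip p.gap) β) {f : BoolFun n | IsIntersecting f} := by
  intro g hg
  have h1 := card_activeControls_mul_lowCount_le (p := p) (e := e) (T := T) (β := β) hg
  have h2 := lowCount_ge hgap
  unfold hdist
  rw [le_div_iff₀ (by positivity)]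
  set X := (Finset.univ.filter fun x => hardFun p e T (noFlip p.gap) β x ≠ g x).card with hX
  have h3 : (labelled p T).card * 2 ^ a ≤ 32 * X := by
    calc _ ≤ (4 * (activeControls p T β).card) * (4 * lowCount a p.gap) := Nat.mul_le_mul hβ h2
      _ = 16 * ((activeControls p T β).card * lowCount a p.gap) := by ring
      _ ≤ 16 * (2 * X) := Nat.mul_le_mul_left _ h1
      _ = _ := by ring
  have h4 : ((labelled p T).card : ℝ) * 2 ^ a ≤ 32 * X := by exact_mod_cast h3
  have h5 : (2 : ℝ) ^ n = 2 ^ a * 2 ^ (2 * p.mid) := by rw [hn, pow_add]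
  have h6 : (0 : ℝ) < 2 ^ a := by positivity
  rw [h5]
  have h7 := mul_le_mul_of_nonneg_right (hε.trans hT) h6.le
  linarith

/-- The hard functions defeat every tester with few queries. -/
theorem success_prob_le {n q a l : ℕ} (hn : n = a + 2 * p.mid) (hal : a * l ≤ n) (hl : 0 < l)
    (hk : 4 ≤ k) (hw : k * p.width ≤ p.mid) (h2w : 2 * p.width ≤ p.mid)
    (hh : 0 < p.mid) (hgap : 4 * p.gap ^ 2 ≤ a) (hgap0 : 0 < p.gap) {η : ℝ} (hη : 0 < η)
    (hQ : 2 * Real.exp 1 * (1 + Real.exp (-(k / (2 * p.mid)))) ^ (2 * p.mid) ≤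
      labelProb / 4 * (η * (window p).card))
    {θ : ℝ} (hθ : 0 ≤ θ) (hθ1 : θ + k / (2 * p.mid) ≤ 1)
    (hθl : 2 * (θ + k / (2 * p.mid)) ≤ k / (2 * p.mid) * l)
    {ε : ℝ} (hε : ε * (64 * 2 ^ (2 * p.mid)) ≤ labelProb * (window p).card)
    {A : RandAlg n q} {s : ℝ} (hA : IsTester A {f : BoolFun n | IsIntersecting f} ε s) :
    2 * s - 1 ≤ 8 / labelProb * Real.exp (1 - θ * p.gap) * q ^ 2 + 16 * η / labelProb ^ 2 := by
  classical
  have hc := labelProb_pos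
  obtain ⟨e, he⟩ := exists_splittings hn hl hal
  obtain ⟨G, hGcard, hG⟩ := exists_good_terms hk hw h2w hh hη hQ
  have hm : 0 < 2 * p.mid := by omega
  have : Nonempty (Fin (2 * p.mid)) := ⟨⟨0, hm⟩⟩
  have : Nonempty (Fin l) := ⟨⟨0, hl⟩⟩
  set N : ℝ := (Fintype.card (Fin (2 ^ k) → Fin k → Fin (2 * p.mid)) : ℝ) with hN
  have hN0 : 0 < N := Nat.cast_pos.2 Fintype.card_pos
  set R : ℝ := (Fintype.card (Fin a → Fin l) : ℝ) with hR
  have hR0 : 0 ≤ R := Nat.cast_nonneg _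
  set M : ℝ := (Fintype.card (Fin (2 ^ k) × Fin (2 ^ k) → Bool) : ℝ) with hM
  have hM0 : 0 ≤ M := Nat.cast_nonneg _
  have hGpos : (0 : ℝ) < G.card := lt_of_lt_of_le (by positivity) hGcard
  have hGne : G.Nonempty := Finset.card_pos.1 (by exact_mod_cast hGpos)
  -- Terms are restricted to the good families, which leaves the yes functions intersecting and
  -- ensures that the no functions fail to be far only for few bit assignments.
  set Ω := (G ×ˢ (Finset.univ : Finset (Fin a → Fin l))) ×ˢ
    (Finset.univ : Finset (Fin (2 ^ k) × Fin (2 ^ k) → Bool)) with hΩ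
  have hΩcard : (Ω.card : ℝ) = G.card * R * M := by
    rw [hΩ, Finset.card_product, Finset.card_product, Finset.card_univ, Finset.card_univ]
    push_cast
    rfl
  have hne : Ω.Nonempty := by
    rw [hΩ]
    exact (hGne.product Finset.univ_nonempty).product Finset.univ_nonempty
  refine yao_principle hA Ω hne (fun ω => hardFun p (e ω.1.2) ω.1.1 yesFlip ω.2)
    (fun ω => hardFun p (e ω.1.2) ω.1.1 (noFlip p.gap) ω.2)
    (fun ω _ => isIntersecting_hardFun (by omega) _ _ _ _) ?_ ?_
  · refine ⟨Ω.filter fun ω => 4 * (activeControls p ω.1.1 ω.2).card < (labelled p ω.1.1).card,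
      Finset.filter_subset _ _, ?_, ?_⟩
    · rw [Finset.card_filter, hΩ, Finset.sum_product, hΩcard, Finset.sum_product, Nat.cast_sum]
      have hT : ∀ T ∈ G, ((∑ r : Fin a → Fin l, ∑ β : Fin (2 ^ k) × Fin (2 ^ k) → Bool,
          if 4 * (activeControls p T β).card < (labelled p T).card then 1 else 0 : ℕ) : ℝ) ≤
          R * (16 * η / labelProb ^ 2 * M) := by
        intro T hT
        rw [Finset.sum_const, ← Finset.card_filter, Finset.card_univ, smul_eq_mul, Nat.cast_mul]
        refine mul_le_mul_of_nonneg_left ?_ hR0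
        have h1 := card_few_active_mul_le (p := p) T
        obtain ⟨hT1, hT2⟩ := hG T hT
        set W : ℝ := ((window p).card : ℝ) with hW
        have hW0 : 0 < W := by
          have h0 : (0 : ℝ) < 64 * 2 ^ (2 * p.mid) := by positivity
          by_contra hcon
          have : W = 0 := le_antisymm (not_lt.1 hcon) (Nat.cast_nonneg _)
          rw [this, mul_zero, mul_zero] at hQ
          have : 0 < 2 * Real.exp 1 * (1 + Real.exp (-(k / (2 * p.mid : ℝ)))) ^ (2 * p.mid) := by
            positivity
          linarith
        set F : ℝ := ((Finset.univ.filter fun β : Fin (2 ^ k) × Fin (2 ^ k) → Bool =>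
          4 * (activeControls p T β).card < (labelled p T).card).card : ℝ) with hF
        have hF0 : 0 ≤ F := Nat.cast_nonneg _
        have h2 : F * (labelProb * W / 2) ^ 2 ≤ 4 * (η * W ^ 2) * M := by
          calc F * (labelProb * W / 2) ^ 2 ≤ F * ((labelled p T).card : ℝ) ^ 2 := by
                gcongr
                linarith
            _ ≤ _ := h1
            _ ≤ _ := by gcongr
        rw [div_mul_eq_mul_div, le_div_iff₀ (by positivity)]
        refine le_of_mul_le_mul_right ?_ (by positivity : 0 < W ^ 2)
        nlinarith
      refine (Finset.sum_le_sum hT).trans (le_of_eq ?_)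
      rw [Finset.sum_const, nsmul_eq_mul]
      ring
    · intro ω hω hωB
      rw [Finset.mem_filter, not_and, not_lt] at hωB
      have hωG : ω.1.1 ∈ G := by
        rw [hΩ, Finset.mem_product, Finset.mem_product] at hω
        exact hω.1.1
      exact isFar_hardFun hn hgap _ (hG _ hωG).1 (hωB hω) hε
  · intro D
    set col : Cube n → Cube n →
        Finset ((Fin (2 ^ k) → Fin k → Fin (2 * p.mid)) × (Fin a → Fin l)) := fun x y =>
      Finset.univ.filter fun ω => Collide p (e ω.2) ω.1 x y with hcol
    set Bad : Finset ((Fin (2 ^ k) → Fin k → Fin (2 * p.mid)) × (Fin a → Fin l)) :=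
      (Finset.univ : Finset (Fin q × Fin q)).biUnion fun bc =>
        col (D.query bc.1) (D.query bc.2) ∪
        col (D.query bc.1) (D.query bc.2)ᶜ
      with hBad
    have hBadcard : (Bad.card : ℝ) ≤ q ^ 2 * (2 * (N * R * Real.exp (1 - θ * p.gap))) := by
      have h1 : (Bad.card : ℝ) ≤ ∑ bc : Fin q × Fin q,
          ((col (D.query bc.1) (D.query bc.2) ∪
            col (D.query bc.1) (D.query bc.2)ᶜ).card : ℝ) := by
        exact_mod_cast Finset.card_biUnion_le
      refine h1.trans ?_
      have h2 : ∀ bc : Fin q × Fin q,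
          ((col (D.query bc.1) (D.query bc.2) ∪
            col (D.query bc.1) (D.query bc.2)ᶜ).card : ℝ) ≤ 2 * (N * R * Real.exp (1 - θ * p.gap)) := by
        intro bc
        have h3 := card_collide_le hw hh hl he hθ hθ1 hθl (D.query bc.1) (D.query bc.2)
        have h4 := card_collide_le hw hh hl he hθ hθ1 hθl (D.query bc.1) (D.query bc.2)ᶜ
        refine (Nat.cast_le.2 (Finset.card_union_le _ _)).trans ?_
        push_cast
        linarith
      refine (Finset.sum_le_sum fun bc _ => h2 bc).trans (le_of_eq ?_)
      rw [Finset.sum_const, Finset.card_univ, Fintype.card_prod, Fintype.card_fin, nsmul_eq_mul]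
      push_cast
      ring
    -- With terms and splitting fixed and no collision, permuting the bits matches the accepting
    -- assignments; otherwise the trivial bound `M` is used.
    have hfib : ∀ ω ∈ G ×ˢ (Finset.univ : Finset (Fin a → Fin l)),
        (((Finset.univ.filter fun β : Fin (2 ^ k) × Fin (2 ^ k) → Bool =>
          D.run (hardFun p (e ω.2) ω.1 yesFlip β) = true).card : ℕ) : ℝ) ≤
        ((Finset.univ.filter fun β : Fin (2 ^ k) × Fin (2 ^ k) → Bool =>
          D.run (hardFun p (e ω.2) ω.1 (noFlip p.gap) β) = true).card : ℕ) +
          if ω ∈ Bad then M else 0 := by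
      intro ω _
      split_ifs with hωB
      · have : ((Finset.univ.filter fun β : Fin (2 ^ k) × Fin (2 ^ k) → Bool =>
          D.run (hardFun p (e ω.2) ω.1 yesFlip β) = true).card : ℝ) ≤ M := by
          rw [hM]
          exact_mod_cast Finset.card_le_univ _
        have h0 : (0 : ℝ) ≤ ((Finset.univ.filter fun β : Fin (2 ^ k) × Fin (2 ^ k) → Bool =>
          D.run (hardFun p (e ω.2) ω.1 (noFlip p.gap) β) = true).card : ℕ) := Nat.cast_nonneg _
        linarith
      · have hnc : ∀ b c, ¬ Collide p (e ω.2) ω.1 (D.query b) (D.query c) ∧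
            ¬ Collide p (e ω.2) ω.1 (D.query b) (D.query c)ᶜ := by
          intro b c
          simp only [hBad, hcol, Finset.mem_biUnion, Finset.mem_univ, true_and, Finset.mem_union,
            Finset.mem_filter, not_exists, not_or] at hωB
          exact hωB (b, c)
        obtain ⟨φ, hφ⟩ := exists_perm_hardFun_eq (by omega) hgap0 D.query hnc
        rw [add_zero]
        refine le_of_eq (congrArg _ (Finset.card_equiv φ fun β => ?_))
        have hrun : D.run (hardFun p (e ω.2) ω.1 yesFlip β) =
            D.run (hardFun p (e ω.2) ω.1 (noFlip p.gap) (φ β)) :=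
          congrArg D.verdict (funext (hφ β))
        rw [Finset.mem_filter, Finset.mem_filter, hrun]
        simp only [Finset.mem_univ, true_and]
    have hsplit : ∀ flip : (Fin a → Bool) → Fin (2 ^ k) → Fin (2 ^ k) → Bool,
        ((Ω.filter fun ω => D.run (hardFun p (e ω.1.2) ω.1.1 flip ω.2) = true).card : ℝ) =
        ∑ ω ∈ G ×ˢ (Finset.univ : Finset (Fin a → Fin l)),
          (((Finset.univ.filter fun β : Fin (2 ^ k) × Fin (2 ^ k) → Bool =>
            D.run (hardFun p (e ω.2) ω.1 flip β) = true).card : ℕ) : ℝ) := by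
      intro flip
      rw [Finset.card_filter, hΩ, Finset.sum_product, Nat.cast_sum]
      simp_rw [Finset.card_filter]
    rw [hsplit, hsplit, hΩcard]
    refine (Finset.sum_le_sum hfib).trans ?_
    rw [Finset.sum_add_distrib]
    refine add_le_add le_rfl ?_
    calc ∑ ω ∈ G ×ˢ (Finset.univ : Finset (Fin a → Fin l)), (if ω ∈ Bad then M else 0)
        ≤ ∑ ω : (Fin (2 ^ k) → Fin k → Fin (2 * p.mid)) × (Fin a → Fin l),
            (if ω ∈ Bad then M else 0) :=
          Finset.sum_le_sum_of_subset_of_nonneg (Finset.subset_univ _) fun _ _ _ => by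
            split_ifs <;> positivity
      _ = Bad.card * M := by
          rw [Finset.sum_ite_mem, Finset.univ_inter, Finset.sum_const, nsmul_eq_mul]
      _ ≤ q ^ 2 * (2 * (N * R * Real.exp (1 - θ * p.gap))) * M := by gcongr
      -- Collisions were counted over all term families; passing to `G` costs the factor `4 /
      -- labelProb`.
      _ = q ^ 2 * 2 * Real.exp (1 - θ * p.gap) * R * M * (4 / labelProb) *
            (labelProb / 4 * N) := by
          field_simp
      _ ≤ q ^ 2 * 2 * Real.exp (1 - θ * p.gap) * R * M * (4 / labelProb) * G.card := by gcongr
      _ = _ := by ring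

end Combine

/-! ### Choice of parameters in terms of `n` and `ε`. -/

section Parameters

/-- The distance needs `w` of order `ε√n`, while terms of length `a` need `a * w ≤ h`; hence `a` of
order `√n / ε`. The gap `t` is of order `√a`, the largest that keeps a constant fraction of action
parts low. -/
theorem exists_params {K ε : ℝ} {n : ℕ} (hK : 1 ≤ K) (hε : 0 < ε) (hεn : 1 ≤ ε * √n)
    (hεK : 3 * K * ε ≤ 1) (hS : 32 * (8 * K) ≤ √n / ε) :
    ∃ a h w t l : ℕ, n = a + 2 * h ∧ a * l ≤ n ∧ 0 < l ∧ 16 ≤ a ∧ 4 * a ≤ n ∧ a * w ≤ h ∧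
      2 * w ≤ h ∧ 0 < h ∧ 2 * w ^ 2 ≤ h ∧ 4 * t ^ 2 ≤ a ∧ 0 < t ∧
      K * ε * √n ≤ w + 1 ∧ √a / 4 ≤ t ∧
      √n / ε / (16 * K) ≤ a ∧ 1 / 16 + (a : ℝ) / (2 * h) ≤ 1 ∧
      2 * (1 / 16 + (a : ℝ) / (2 * h)) ≤ a / (2 * h) * l := by
  set S : ℝ := √n / ε with hSdef
  have hKpos : 0 < K := by linarith
  have hsqn : √(n : ℝ) * √n = n := Real.mul_self_sqrt (Nat.cast_nonneg n)
  have hSn : S ≤ n := by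
    rw [hSdef, div_le_iff₀ hε]
    nlinarith [Real.sqrt_nonneg (n : ℝ)]
  have hSε : S * (ε * √n) = n := by
    calc S * (ε * √n) = √n * √n := by rw [hSdef]; field_simp
      _ = n := hsqn
  set x : ℝ := S / (8 * K) with hx
  have hxS : x * (8 * K) = S := by rw [hx]; field_simp
  have hx32 : 32 ≤ x := by rw [hx, le_div_iff₀ (by positivity)]; exact hS
  have hx8 : 8 * x ≤ S := by nlinarith
  set a₀ := ⌊x⌋₊ with ha₀
  have h1 : (a₀ : ℝ) ≤ x := Nat.floor_le (by linarith)
  have h2 : x < a₀ + 1 := Nat.lt_floor_add_one x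
  have ha₀n : a₀ ≤ n := by
    have : (a₀ : ℝ) ≤ n := by linarith
    exact_mod_cast this
  -- The parity is adjusted because the control part must have even dimension `2h`.
  obtain ⟨a, ha1, ha2, ha3⟩ : ∃ a : ℕ, a₀ ≤ a ∧ a ≤ a₀ + 1 ∧ (n + a) % 2 = 0 :=
    ⟨a₀ + (n + a₀) % 2, by omega, by omega, by omega⟩
  have ha1' : (a₀ : ℝ) ≤ a := by exact_mod_cast ha1
  have ha2' : (a : ℝ) ≤ a₀ + 1 := by exact_mod_cast ha2
  have hax : x / 2 ≤ a := by linarith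
  have hax2 : (a : ℝ) ≤ 2 * x := by linarith
  have han : 4 * a ≤ n := by
    have : 4 * (a : ℝ) ≤ n := by linarith
    exact_mod_cast this
  have ha16 : 16 ≤ a := by
    have : (16 : ℝ) ≤ a := by linarith
    exact_mod_cast this
  obtain ⟨h, hh⟩ : ∃ h, n = a + 2 * h := ⟨(n - a) / 2, by omega⟩
  have hhn : 3 * n ≤ 8 * h := by omega
  have hhn' : 3 * (n : ℝ) ≤ 8 * h := by exact_mod_cast hhn
  have hnpos : (0 : ℝ) < n := by linarith
  have hhpos : (0 : ℝ) < h := by linarith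
  set w := ⌊K * ε * √n⌋₊ with hw
  have hw0 : 0 ≤ K * ε * √n := by positivity
  have hw1 : (w : ℝ) ≤ K * ε * √n := Nat.floor_le hw0
  have hw2 : K * ε * √n < w + 1 := Nat.lt_floor_add_one _
  have haw : a * w ≤ h := by
    have h3 : (a : ℝ) * w ≤ 2 * x * (K * ε * √n) := by gcongr
    have h4 : 2 * x * (K * ε * √n) = n / 4 := by
      linear_combination (1 / 4) * hSε + (ε * √n / 4) * hxS
    have : (a : ℝ) * w ≤ h := by linarith
    exact_mod_cast this
  have h2w : 2 * w ≤ h := by nlinarith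
  have h2w2 : 2 * w ^ 2 ≤ h := by
    have h3 : (w : ℝ) ^ 2 ≤ (K * ε * √n) ^ 2 := by gcongr
    have h4 : (K * ε * √n) ^ 2 = (K * ε) ^ 2 * n := by
      rw [mul_pow, Real.sq_sqrt (Nat.cast_nonneg n)]
    have h5 : (K * ε) ^ 2 ≤ (1 / 3) ^ 2 := by
      gcongr
      linarith
    have h6 : (K * ε) ^ 2 * n ≤ (1 / 3) ^ 2 * n := by gcongr
    have : 2 * (w : ℝ) ^ 2 ≤ h := by linarith
    exact_mod_cast this
  set t := ⌊√(a : ℝ) / 2⌋₊ with ht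
  have hsa4 : 4 ≤ √(a : ℝ) := by
    rw [show (4 : ℝ) = √16 by rw [show (16 : ℝ) = 4 ^ 2 by norm_num]; simp]
    exact Real.sqrt_le_sqrt (by exact_mod_cast ha16)
  have ht1 : (t : ℝ) ≤ √a / 2 := Nat.floor_le (by positivity)
  have ht2 : √(a : ℝ) / 2 < t + 1 := Nat.lt_floor_add_one _
  have ht3 : √(a : ℝ) / 4 ≤ t := by linarith
  have ht4 : 4 * t ^ 2 ≤ a := by
    have h3 : (t : ℝ) ^ 2 ≤ (√a / 2) ^ 2 := by gcongr
    rw [div_pow, Real.sq_sqrt (Nat.cast_nonneg a)] at h3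
    have : 4 * (t : ℝ) ^ 2 ≤ a := by linarith
    exact_mod_cast this
  have ht0 : 0 < t := by
    have : (0 : ℝ) < t := by linarith
    exact_mod_cast this
  set l := n / a with hl
  have hl1 : a * l ≤ n := Nat.mul_div_le n a
  have hl4 : 4 ≤ l := (Nat.le_div_iff_mul_le (by omega)).2 (by omega)
  have hl2 : n < a * (l + 1) := Nat.lt_mul_div_succ n (by omega)
  have hl2' : (n : ℝ) < a * (l + 1) := by exact_mod_cast hl2
  have hl4' : (4 : ℝ) ≤ l := by exact_mod_cast hl4
  have hh' : (n : ℝ) = a + 2 * h := by exact_mod_cast hh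
  have ha0 : (0 : ℝ) ≤ a := Nat.cast_nonneg a
  refine ⟨a, h, w, t, l, hh, hl1, by omega, ha16, han, haw, h2w, by exact_mod_cast hhpos, h2w2, ht4,
    ht0, hw2.le, ht3, ?_, ?_, ?_⟩
  · refine le_trans (le_of_eq ?_) hax
    rw [hx]
    field_simp
    ring
  · have : (a : ℝ) / (2 * h) ≤ 1 / 3 := by
      rw [div_le_iff₀ (by positivity)]
      have : 4 * (a : ℝ) ≤ n := by exact_mod_cast han
      linarith
    linarith
  -- Half of the right-hand side absorbs the constant `1/8`; the other half absorbs the remaining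
  -- term because `l ≥ 4`.
  · have h3 : 1 / 2 ≤ (a : ℝ) / (2 * h) * l := by
      rw [div_mul_eq_mul_div, le_div_iff₀ (by positivity)]
      linarith
    have h4 : 0 ≤ (a : ℝ) / (2 * h) := by positivity
    linarith [mul_le_mul_of_nonneg_left hl4' h4]

/-- The saving `exp(-a/4)` over the cube size makes pairs with equal labels negligible against the
squared window size. -/
theorem one_add_exp_neg_pow_le {a h : ℕ} (hh : 0 < h) (hah : a ≤ 2 * h) :
    (1 + Real.exp (-(a / (2 * h : ℝ)))) ^ (2 * h) ≤ 2 ^ (2 * h) * Real.exp (-(a / 4 : ℝ)) := by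
  have hpos : (0 : ℝ) < h := by exact_mod_cast hh
  set x : ℝ := a / (2 * h) with hx
  have hx0 : 0 ≤ x := by positivity
  have hx1 : x ≤ 1 := by
    rw [hx, div_le_one (by positivity)]
    exact_mod_cast hah
  have h1 : Real.exp (-x) ≤ 1 - x / 2 := by
    rw [Real.exp_neg, inv_le_iff_one_le_mul₀ (Real.exp_pos x)]
    have := Real.add_one_le_exp x
    nlinarith
  have h2 : 1 + Real.exp (-x) ≤ 2 * Real.exp (-(x / 4)) := by
    have := Real.add_one_le_exp (-(x / 4))
    linarith
  calc (1 + Real.exp (-x)) ^ (2 * h) ≤ (2 * Real.exp (-(x / 4))) ^ (2 * h) := by gcongr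
    _ = 2 ^ (2 * h) * Real.exp (-(a / 4 : ℝ)) := by
        rw [mul_pow, ← Real.exp_nat_mul]
        congr 2
        rw [hx]
        push_cast
        field_simp

theorem labelProb_le_one : labelProb ≤ 1 := by
  unfold labelProb
  have : Real.exp (-12) ≤ 1 := Real.exp_le_one_iff.2 (by norm_num)
  linarith

/-- The combined bound, with the parameters chosen in terms of `n` and `ε`. -/
theorem success_prob_le_of_large {n q : ℕ} {K ε η : ℝ} (hK : K = 256 / labelProb) (hη : 0 < η)
    (hε : 0 < ε) (hεn : 1 ≤ ε * √n) (hεK : 3 * K * ε ≤ 1) (hS : 32 * (8 * K) ≤ √n)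
    (hn : 49152 * (16 * K) ^ 2 / (labelProb * η) ≤ √n)
    {A : RandAlg n q} {s : ℝ} (hA : IsTester A {f : BoolFun n | IsIntersecting f} ε s) :
    2 * s - 1 ≤ 24 / labelProb * Real.exp (-(√(√n / ε) / (64 * √(16 * K)))) * q ^ 2 +
      16 * η / labelProb ^ 2 := by
  have hc := labelProb_pos
  have hc1 := labelProb_le_one
  have hK1 : 1 ≤ K := by rw [hK, le_div_iff₀ hc]; linarith
  have hε1 : ε ≤ 1 := by nlinarith
  have hSn : √(n : ℝ) ≤ √n / ε := le_div_self (Real.sqrt_nonneg _) hε hε1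
  obtain ⟨a, h, w, t, l, hnah, hal, hl, ha16, han, haw, h2w, hh, h2w2, hta, ht0, hwK, hat, haS,
    hθ1, hθl⟩ := exists_params hK1 hε hεn hεK (hS.trans hSn)
  have hhR : (0 : ℝ) < h := by exact_mod_cast hh
  have hsqh : 0 < √(h : ℝ) := Real.sqrt_pos.2 hhR
  have hhn : √(h : ℝ) ≤ √n := Real.sqrt_le_sqrt (by exact_mod_cast (by omega : h ≤ n))
  have hnpos : 0 < √(n : ℝ) := by nlinarith
  set p : HardParams := ⟨h, w, t⟩ with hp
  have hW : ((w : ℝ) + 1) * 2 ^ (2 * h) / (4 * √h) ≤ (window p).card :=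
    card_window_ge (p := p) hh h2w2
  have hεW : ε * (64 * 2 ^ (2 * h)) ≤ labelProb * (window p).card := by
    have h1 : ε * (64 * 2 ^ (2 * h)) ≤
        labelProb * (((w : ℝ) + 1) * 2 ^ (2 * h) / (4 * √h)) := by
      rw [mul_div_assoc', le_div_iff₀ (by positivity)]
      have h2 : 256 * ε * √h ≤ labelProb * (w + 1) := by
        calc 256 * ε * √h ≤ 256 * ε * √n := by gcongr
          _ = labelProb * (K * ε * √n) := by rw [hK]; field_simp
          _ ≤ _ := by gcongr
      calc _ = 256 * ε * √h * 2 ^ (2 * h) := by ring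
        _ ≤ labelProb * (w + 1) * 2 ^ (2 * h) := by gcongr
        _ = _ := by ring
    exact h1.trans (by gcongr)
  have hQ : 2 * Real.exp 1 * (1 + Real.exp (-(a / (2 * h : ℝ)))) ^ (2 * h) ≤
      labelProb / 4 * (η * (window p).card) := by
    have h1 : (2 : ℝ) ^ (2 * h) / (4 * √h) ≤ (window p).card := by
      refine le_trans ?_ hW
      gcongr
      exact le_mul_of_one_le_left (by positivity) (by linarith [Nat.cast_nonneg (α := ℝ) w])
    have h2 := one_add_exp_neg_pow_le (a := a) hh (by omega)
    -- Quadratic growth of the exponential suffices: `a²` is at least a constant times `n`, which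
    -- beats `√h` for large `n`.
    have h3 : 96 * √(h : ℝ) ≤ labelProb * η * Real.exp (a / 4) := by
      have h4 : ((a : ℝ) / 4) ^ 2 / 2 ≤ Real.exp (a / 4) := by
        have := Real.quadratic_le_exp_of_nonneg (x := (a : ℝ) / 4) (by positivity)
        have : 0 ≤ (a : ℝ) / 4 := by positivity
        linarith
      have h5 : √(n : ℝ) / (16 * K) ≤ a := le_trans (by gcongr) haS
      have h6 : (√(n : ℝ) / (16 * K)) ^ 2 ≤ (a : ℝ) ^ 2 := by gcongr
      rw [div_le_iff₀ (by positivity)] at hn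
      rw [div_pow, div_le_iff₀ (by positivity)] at h6
      have h7 : 49152 * (16 * K) ^ 2 * √n ≤ (a : ℝ) ^ 2 * (16 * K) ^ 2 * (labelProb * η) := by
        calc 49152 * (16 * K) ^ 2 * √n ≤ √n * (labelProb * η) * √n := by gcongr
          _ = √n ^ 2 * (labelProb * η) := by ring
          _ ≤ _ := by gcongr
      have h8 : 49152 * √(n : ℝ) ≤ (a : ℝ) ^ 2 * (labelProb * η) := by
        refine le_of_mul_le_mul_right ?_ (by positivity : 0 < (16 * K) ^ 2)
        linarith
      calc 96 * √(h : ℝ) ≤ 96 * √n := by gcongr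
        _ ≤ labelProb * η * (((a : ℝ) / 4) ^ 2 / 2) := by nlinarith
        _ ≤ _ := by gcongr
    have he : Real.exp 1 ≤ 3 := Real.exp_one_lt_three.le
    calc _ ≤ 2 * 3 * (2 ^ (2 * h) * Real.exp (-(a / 4 : ℝ))) := by gcongr
      _ = 96 * √h * (2 ^ (2 * h) / (16 * √h) * Real.exp (-(a / 4 : ℝ))) := by
          field_simp
          norm_num
      _ ≤ labelProb * η * Real.exp (a / 4) *
          (2 ^ (2 * h) / (16 * √h) * Real.exp (-(a / 4 : ℝ))) := by gcongr
      _ = labelProb / 4 * (η * (2 ^ (2 * h) / (4 * √h))) := by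
          rw [Real.exp_neg]
          field_simp
          norm_num
      _ ≤ _ := by gcongr
  have key := success_prob_le (p := p) (k := a) hnah hal hl (by omega) haw h2w hh hta ht0 hη hQ
    (θ := 1 / 16) (by norm_num) hθ1 hθl hεW hA
  refine key.trans ?_
  gcongr ?_ * _ + _
  rw [sub_eq_add_neg, Real.exp_add, ← mul_assoc]
  have h9 : √(√n / ε) / (64 * √(16 * K)) ≤ 1 / 16 * (t : ℝ) := by
    have h10 : √(√n / ε) / √(16 * K) ≤ √a := by
      rw [← Real.sqrt_div (by positivity)]
      exact Real.sqrt_le_sqrt haS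
    have h11 : √(√n / ε) / (64 * √(16 * K)) = √(√n / ε) / √(16 * K) / 64 := by
      rw [div_div, mul_comm (64 : ℝ)]
    rw [h11]
    linarith
  gcongr ?_ * Real.exp ?_
  · have he : Real.exp 1 ≤ 3 := Real.exp_one_lt_three.le
    calc 8 / labelProb * Real.exp 1 ≤ 8 / labelProb * 3 := by gcongr
      _ = _ := by ring
  · exact neg_le_neg h9

theorem rpow_quarter_div_sqrt {n : ℕ} {ε : ℝ} :
    (n : ℝ) ^ (1 / 4 : ℝ) / √ε = √(√n / ε) := by
  rw [Real.sqrt_div (Real.sqrt_nonneg _)]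
  congr 1
  rw [Real.sqrt_eq_rpow, Real.sqrt_eq_rpow, ← Real.rpow_mul (Nat.cast_nonneg n)]
  norm_num

end Parameters

end PropertyTesting

/-! ### The theorem, with the constants fixed. -/

theorem theorem1p2 (p : ℝ) (hp : 1 / 2 < p) :
    ∃ c : ℝ, 0 < c ∧ ∃ κ : ℝ, 0 < κ ∧
      ∀ (n : ℕ) (ε : ℝ), 0 < n → 1 / Real.sqrt (n : ℝ) ≤ ε → ε < c →
        ∀ (q : ℕ) (A : PropertyTesting.RandAlg n q),
          PropertyTesting.IsTester A
              {f : PropertyTesting.BoolFun n | PropertyTesting.IsIntersecting f} ε p →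
            (2 : ℝ) ^ (κ * ((n : ℝ) ^ (1 / 4 : ℝ) / Real.sqrt ε)) ≤ (q : ℝ) := by
  have hc := PropertyTesting.labelProb_pos
  set b := PropertyTesting.labelProb with hb
  set γ : ℝ := 2 * p - 1 with hγ
  have hγ0 : 0 < γ := by rw [hγ]; linarith
  set K : ℝ := 256 / b with hK
  have hK0 : 0 < K := by positivity
  -- Chosen so that the second-moment error `16 η / b²` equals `γ / 4`.
  set η : ℝ := b ^ 2 * γ / 64 with hη
  have hη0 : 0 < η := by positivity
  set ρ : ℝ := 1 / (64 * √(16 * K)) with hρ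
  have hρ0 : 0 < ρ := by positivity
  -- Each summand is one largeness requirement. As `1/√n ≤ ε < 1/X`, both `ε X < 1` and `X ≤ √n`
  -- hold, so the bound on `ε` also makes `n` large.
  set X : ℝ := 3 * K + 32 * (8 * K) + 49152 * (16 * K) ^ 2 / (b * η) + (96 / (b * γ * ρ)) ^ 2 + 1
    with hX
  have hX1 : 0 < 49152 * (16 * K) ^ 2 / (b * η) := by positivity
  have hX2 : 0 < (96 / (b * γ * ρ)) ^ 2 := by positivity
  have hX0 : 0 < X := by positivity
  -- With exponent `ρ / 4`, too few queries give `q² ≤ exp(ρN/2)`, which uses up only half of the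
  -- decay `exp(-ρN)`. The total error is then at most `3γ/4 < γ`.
  refine ⟨1 / X, by positivity, ρ / 4, by positivity, fun n ε hn hε hεc q A hA => ?_⟩
  have hsn : 0 < √(n : ℝ) := Real.sqrt_pos.2 (by exact_mod_cast hn)
  have hε0 : 0 < ε := lt_of_lt_of_le (by positivity) hε
  have hεn : 1 ≤ ε * √n := by rwa [div_le_iff₀ hsn] at hε
  have hεX : ε * X < 1 := by rwa [lt_div_iff₀ hX0] at hεc
  have hXn : X ≤ √n := by nlinarith
  have hε1 : ε ≤ 1 := by nlinarith
  rw [PropertyTesting.rpow_quarter_div_sqrt]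
  set N : ℝ := √(√n / ε) with hN
  have hXN : 96 / (b * γ * ρ) ≤ N := by
    refine Real.le_sqrt_of_sq_le ?_
    have := le_div_self hsn.le hε0 hε1
    linarith
  have hN0 : 0 ≤ N := Real.sqrt_nonneg _
  by_contra hq
  rw [not_le] at hq
  have main := PropertyTesting.success_prob_le_of_large hK hη0 hε0 hεn (by nlinarith) (by linarith)
    (by linarith) hA
  rw [← hN, ← hb, ← hγ] at main
  have e1 : 16 * η / b ^ 2 = γ / 4 := by
    rw [hη]
    field_simp
    norm_num
  have e2 : N / (64 * √(16 * K)) = ρ * N := by rw [hρ]; ring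
  rw [e1, e2] at main
  have hq2 : (q : ℝ) ^ 2 ≤ Real.exp (ρ * N / 2) := by
    have h1 : (2 : ℝ) ^ (ρ / 4 * N) ≤ Real.exp (ρ / 4 * N) := by
      rw [← Real.exp_one_rpow]
      have : (2 : ℝ) ≤ Real.exp 1 := by linarith [Real.add_one_le_exp (1 : ℝ)]
      gcongr
    calc (q : ℝ) ^ 2 ≤ Real.exp (ρ / 4 * N) ^ 2 := by
          gcongr
          exact hq.le.trans h1
      _ = _ := by
          rw [← Real.exp_nat_mul]
          congr 1
          push_cast
          ring
  have h2 : 24 / b * Real.exp (-(ρ * N)) * q ^ 2 ≤ γ / 2 := by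
    calc _ ≤ 24 / b * Real.exp (-(ρ * N)) * Real.exp (ρ * N / 2) := by gcongr
      _ = 24 / b * Real.exp (-(ρ * N / 2)) := by
          rw [mul_assoc, ← Real.exp_add]
          congr 2
          ring
      _ ≤ γ / 2 := by
          rw [Real.exp_neg, ← div_eq_mul_inv, div_le_iff₀ (Real.exp_pos _), div_le_iff₀ hc]
          have h3 := Real.add_one_le_exp (ρ * N / 2)
          rw [div_le_iff₀ (by positivity)] at hXN
          have h4 : 0 < γ * b := by positivity
          nlinarith
  linarith
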